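/- Let $(K,\nu_0)$ be a valued field and $\Gamma$ a totally ordered divisible abelian group containing the value group of $\nu_0$; put $\Gamma_\infty=\Gamma\cup\{\infty\}$. Let $\mathcal V$ be the set of all valuations $\nu:K[x]\to\Gamma_\infty$ extending $\nu_0$ (valuations may have non-zero support $\operatorname{supp}(\nu)=\{f:\nu(f)=\infty\}$), ordered by $\nu\le\mu$ iff $\nu(f)\le\mu(f)$ for all $f\in K[x]$. Let $F\in K[x]$ be monic and irreducible and let $$\mathcal V_F=\{\nu\in\mathcal V\mid \nu\le\mu\text{ for some }\mu\in\mathcal V\text{ with }\operatorname{supp}(\mu)=(F)\}.$$ For $\nu\in\mathcal V$ let $\mathcal G_\nu=\bigoplus_{\gamma}\{f:\nu(f)\ge\gamma\}/\{f:\nu(f)>\gamma\}$ be its graded ring, where $\gamma$ runs over the finite values of $\nu$, and let $\operatorname{in}_\nu(f)$ be the class of $f$ in degree $\nu(f)$ (and $\operatorname{in}_\nu(f)=0$ if $\nu(f)=\infty$). A key polynomial for $\nu$, that is, an element of $\mathrm{KP}(\nu)$, is a monic $Q\in K[x]$ such that $\operatorname{in}_\nu(Q)$ is a prime element of $\mathcal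 G_\nu$ and $\deg Q\le\deg f$ for every non-zero $f\in K[x]$ with $\operatorname{in}_\nu(Q)\mid\operatorname{in}_\nu(f)$. **Theorem.** Let $\nu\in\mathcal V_F$ not be a maximal element of $\mathcal V$, let $\phi\in\mathcal G_\nu$ be a homogeneous irreducible factor of $\operatorname{in}_\nu(F)$, and let $\phi=u\cdot\operatorname{in}_\nu(Q)$ with $u$ a unit of $\mathcal G_\nu$ and $Q\in\mathrm{KP}(\nu)$. Write $F=f_0+f_1Q+\dots+f_rQ^r$ with $\deg f_i<\deg Q$. Define $\alpha_1\in\Gamma_\infty$ as follows: if $Q\ne F$, then $\alpha_1\in\Gamma$ is minus the slope of the first side (the one starting at $(0,\nu(f_0))$) of the Newton polygon of $F$ with respect to $Q$ and $\nu$, that is, of the lower boundary of the convex hull in $\mathbb Q\times\Gamma$ of the points $(i,\nu(f_i))$, $\nu(f_i)\neq\infty$ (this first side exists); if $Q=F$, then $\alpha_1=\infty$. Then $\nu(Q)<\alpha_1$, and there is $\mu\in\mathcal V_F$ with $\mu(Q)=\alpha_1$ such that every $\mu'\in\mathcal V_F$ with $\mu\le\mu'$ satisfies $\mu'(Q)=\alpha_1$.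 -/

import Mathlib

noncomputable section

open Polynomial

namespace ValApproach

/-! ### The graded ring of a valuation -/

section Graded

variable {Γ : Type*} [AddCommGroup Γ] [LinearOrder Γ] [IsOrderedAddMonoid Γ]
variable {R : Type*} [CommRing R] (ν : AddValuation R (WithTop Γ))

/-- The group `P_γ = {a ∈ R | ν(a) ≥ γ}`. -/
def geSubgroup (γ : Γ) : AddSubgroup R where
  carrier := {a | (γ : WithTop Γ) ≤ ν a}
  zero_mem' := by simp
  add_mem' := fun ha hb => ν.map_le_add ha hb
  neg_mem' := fun {a} ha => by simpa using ha

/-- The group `P_γ⁺ = {a ∈ R | ν(a) > γ}`. -/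
def gtSubgroup (γ : Γ) : AddSubgroup R where
  carrier := {a | (γ : WithTop Γ) < ν a}
  zero_mem' := by simp
  add_mem' := fun ha hb => ν.map_lt_add ha hb
  neg_mem' := fun {a} ha => by simpa using ha

/-- The homogeneous component `P_γ / P_γ⁺`. -/
abbrev GrComp (γ : Γ) : Type _ :=
  geSubgroup ν γ ⧸ (gtSubgroup ν γ).addSubgroupOf (geSubgroup ν γ)

/-- The class in `P_γ / P_γ⁺` of an element `a` with `ν(a) ≥ γ`. -/
def grMk (γ : Γ) (a : R) (h : (γ : WithTop Γ) ≤ ν a) : GrComp ν γ :=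
  QuotientAddGroup.mk (⟨a, h⟩ : geSubgroup ν γ)

variable {ν}

theorem grMk_surj {γ : Γ} (x : GrComp ν γ) : ∃ a h, x = grMk ν γ a h := by
  induction x using QuotientAddGroup.induction_on with
  | H a => exact ⟨a.1, a.2, rfl⟩

theorem grMk_eq_iff {γ : Γ} {a b : R} {ha hb} :
    grMk ν γ a ha = grMk ν γ b hb ↔ (γ : WithTop Γ) < ν (b - a) := by
  unfold grMk
  rw [QuotientAddGroup.eq, AddSubgroup.mem_addSubgroupOf]
  change (γ : WithTop Γ) < ν (-a + b) ↔ _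
  rw [neg_add_eq_sub]

theorem le_mul {γ δ : Γ} {a b : R} (ha : (γ : WithTop Γ) ≤ ν a) (hb : (δ : WithTop Γ) ≤ ν b) :
    ((γ + δ : Γ) : WithTop Γ) ≤ ν (a * b) := by
  rw [ν.map_mul, WithTop.coe_add]
  exact add_le_add ha hb

theorem lt_mul_left {γ δ : Γ} {a b : R} (ha : (γ : WithTop Γ) < ν a)
    (hb : (δ : WithTop Γ) ≤ ν b) : ((γ + δ : Γ) : WithTop Γ) < ν (a * b) := by
  rw [ν.map_mul, WithTop.coe_add]
  exact lt_of_lt_of_le (WithTop.add_lt_add_right WithTop.coe_ne_top ha) (by gcongr)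

theorem lt_mul_right {γ δ : Γ} {a b : R} (ha : (γ : WithTop Γ) ≤ ν a)
    (hb : (δ : WithTop Γ) < ν b) : ((γ + δ : Γ) : WithTop Γ) < ν (a * b) := by
  rw [mul_comm, add_comm]
  exact lt_mul_left hb ha

/-- Multiplication `P_γ/P_γ⁺ × P_δ/P_δ⁺ → P_{γ+δ}/P_{γ+δ}⁺`, induced by that of `R`. -/
def grMul {γ δ : Γ} (x : GrComp ν γ) (y : GrComp ν δ) : GrComp ν (γ + δ) :=
  Quotient.liftOn₂' x y (fun a b => grMk ν (γ + δ) (a.1 * b.1) (le_mul a.2 b.2)) (by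
    rintro ⟨a, ha⟩ ⟨b, hb⟩ ⟨a', ha'⟩ ⟨b', hb'⟩ h1 h2
    have h1' : (γ : WithTop Γ) < ν (a' - a) :=
      grMk_eq_iff (ha := ha) (hb := ha').1 (Quotient.sound' h1)
    have h2' : (δ : WithTop Γ) < ν (b' - b) :=
      grMk_eq_iff (ha := hb) (hb := hb').1 (Quotient.sound' h2)
    refine grMk_eq_iff.2 ?_
    have e : a' * b' - a * b = (a' - a) * b' + a * (b' - b) := by ring
    change _ < ν (a' * b' - a * b)
    rw [e]
    exact ν.map_lt_add (lt_mul_left h1' hb') (lt_mul_right ha h2'))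

theorem grMul_mk {γ δ : Γ} {a b : R} (ha hb) :
    grMul (grMk ν γ a ha) (grMk ν δ b hb) = grMk ν (γ + δ) (a * b) (le_mul ha hb) := rfl

theorem grMk_add {γ : Γ} {a b : R} (ha hb) :
    grMk ν γ a ha + grMk ν γ b hb = grMk ν γ (a + b) (ν.map_le_add ha hb) := rfl

theorem grMk_zero {γ : Γ} (h) : grMk ν γ 0 h = 0 := rfl

theorem grMk_congr {γ δ : Γ} {a b : R} {ha hb} (h : γ = δ) (h' : a = b) :
    GradedMonoid.mk (A := GrComp ν) γ (grMk ν γ a ha) = GradedMonoid.mk δ (grMk ν δ b hb) := by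
  subst h; subst h'; rfl

theorem zero_le_natCast (n : ℕ) : ((0 : Γ) : WithTop Γ) ≤ ν (n : R) := by
  induction n with
  | zero => simp
  | succ n ih =>
    rw [Nat.cast_succ]
    exact ν.map_le_add ih (by simp)

theorem zero_le_intCast (n : ℤ) : ((0 : Γ) : WithTop Γ) ≤ ν (n : R) := by
  cases n with
  | ofNat n => simpa using zero_le_natCast (ν := ν) n
  | negSucc n =>
    rw [Int.cast_negSucc, AddValuation.map_neg]
    exact zero_le_natCast _

instance : GradedMonoid.GMul (GrComp ν) where
  mul := grMul

instance : GradedMonoid.GOne (GrComp ν) where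
  one := grMk ν 0 1 (by simp)

instance : GradedMonoid.GMonoid (GrComp ν) where
  one_mul := by
    rintro ⟨γ, x⟩
    obtain ⟨a, h, rfl⟩ := grMk_surj x
    exact grMk_congr (zero_add _) (one_mul _)
  mul_one := by
    rintro ⟨γ, x⟩
    obtain ⟨a, h, rfl⟩ := grMk_surj x
    exact grMk_congr (add_zero _) (mul_one _)
  mul_assoc := by
    rintro ⟨γ, x⟩ ⟨δ, y⟩ ⟨ε, z⟩
    obtain ⟨a, h, rfl⟩ := grMk_surj x
    obtain ⟨b, h', rfl⟩ := grMk_surj y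
    obtain ⟨c, h'', rfl⟩ := grMk_surj z
    exact grMk_congr (add_assoc _ _ _) (mul_assoc _ _ _)

instance : DirectSum.GCommRing (GrComp ν) where
  mul_zero := by
    intro γ δ x
    obtain ⟨a, h, rfl⟩ := grMk_surj x
    change grMul (grMk ν γ a h) (grMk ν δ 0 (by simp)) = grMk ν (γ + δ) 0 (by simp)
    rw [grMul_mk]; congr 1; exact mul_zero _
  zero_mul := by
    intro γ δ x
    obtain ⟨a, h, rfl⟩ := grMk_surj x
    change grMul (grMk ν γ 0 (by simp)) (grMk ν δ a h) = grMk ν (γ + δ) 0 (by simp)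
    rw [grMul_mk]; congr 1; exact zero_mul _
  mul_add := by
    intro γ δ x y z
    obtain ⟨a, h, rfl⟩ := grMk_surj x
    obtain ⟨b, h', rfl⟩ := grMk_surj y
    obtain ⟨c, h'', rfl⟩ := grMk_surj z
    change grMul _ _ = grMul _ _ + grMul _ _
    simp only [grMk_add, grMul_mk]; congr 1; exact mul_add _ _ _
  add_mul := by
    intro γ δ x y z
    obtain ⟨a, h, rfl⟩ := grMk_surj x
    obtain ⟨b, h', rfl⟩ := grMk_surj y
    obtain ⟨c, h'', rfl⟩ := grMk_surj z
    change grMul _ _ = grMul _ _ + grMul _ _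
    simp only [grMk_add, grMul_mk]; congr 1; exact add_mul _ _ _
  mul_comm := by
    rintro ⟨γ, x⟩ ⟨δ, y⟩
    obtain ⟨a, h, rfl⟩ := grMk_surj x
    obtain ⟨b, h', rfl⟩ := grMk_surj y
    exact grMk_congr (add_comm _ _) (mul_comm _ _)
  natCast n := grMk ν 0 n (zero_le_natCast n)
  natCast_zero := by
    rw [← grMk_zero (ν := ν) (by simp)]; congr 1; exact Nat.cast_zero
  natCast_succ n := by
    change _ = _ + grMk ν 0 1 (by simp)
    rw [grMk_add]; congr 1; exact Nat.cast_succ n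
  intCast n := grMk ν 0 n (zero_le_intCast n)
  intCast_ofNat n := by
    congr 1; exact Int.cast_natCast n
  intCast_negSucc_ofNat n := by
    change _ = grMk ν 0 (-((n + 1 : ℕ) : R)) _
    congr 1; exact Int.cast_negSucc n

variable (ν)

/-- The graded ring `gr_ν(R) = ⨁ P_γ/P_γ⁺`. The sum runs over all `γ ∈ Γ`; the components with
`γ ∉ ν(R)` vanish, so this is the sum over the finite values of `ν`. -/
abbrev Gr : Type _ := DirectSum Γ (GrComp ν)

/-- The initial form `in_ν(a)`: the class of `a` in degree `ν(a)`, and `0` on the support. -/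
def initialForm (a : R) : Gr ν :=
  if h : ν a = ⊤ then 0
  else DirectSum.of (GrComp ν) ((ν a).untop h) (grMk ν _ a (by simp))

/-- Homogeneous elements of the graded ring. -/
def IsHomogeneousElem (φ : Gr ν) : Prop :=
  ∃ (γ : Γ) (x : GrComp ν γ), φ = DirectSum.of (GrComp ν) γ x

end Graded

/-! ### Valuations on `K[x]` extending `ν₀` -/

section Valuations

variable {Γ : Type*} [AddCommGroup Γ] [LinearOrder Γ] [IsOrderedAddMonoid Γ]
variable {K : Type*} [Field K]

/-- The set `𝒱` of all valuations `K[x] → Γ ∪ {∞}` that extend `ν₀`. -/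
def extVals (ν₀ : AddValuation K (WithTop Γ)) : Set (AddValuation K[X] (WithTop Γ)) :=
  {ν | ∀ a : K, ν (C a) = ν₀ a}

/-- The order of `𝒱`: `ν(f) ≤ μ(f)` for every `f`. -/
def ValLE (ν μ : AddValuation K[X] (WithTop Γ)) : Prop := ∀ f : K[X], ν f ≤ μ f

/-- `ν` is a maximal element of `𝒱`. -/
def IsMaximalVal (ν₀ : AddValuation K (WithTop Γ)) (ν : AddValuation K[X] (WithTop Γ)) : Prop :=
  ν ∈ extVals ν₀ ∧ ∀ μ ∈ extVals ν₀, ValLE ν μ → μ = ν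

/-- The valuations in `𝒱` with support `(F)`. -/
def valsSupp (ν₀ : AddValuation K (WithTop Γ)) (F : K[X]) :
    Set (AddValuation K[X] (WithTop Γ)) :=
  {μ | μ ∈ extVals ν₀ ∧ μ.supp = Ideal.span {F}}

/-- The set `𝒱_F` of the valuations in `𝒱` that approach `F`. -/
def valsApproaching (ν₀ : AddValuation K (WithTop Γ)) (F : K[X]) :
    Set (AddValuation K[X] (WithTop Γ)) :=
  {ν | ν ∈ extVals ν₀ ∧ ∃ μ ∈ valsSupp ν₀ F, ValLE ν μ}

/-- Mac Lane-Vaquié key polynomials for `ν`. (The zero polynomial has no degree to compare with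
and is left out of the minimality condition.) -/
def IsKeyPoly (ν : AddValuation K[X] (WithTop Γ)) (Q : K[X]) : Prop :=
  Q.Monic ∧ Prime (initialForm ν Q) ∧
    ∀ f : K[X], f ≠ 0 → initialForm ν Q ∣ initialForm ν f → Q.natDegree ≤ f.natDegree

/-- The coefficient `f_i` of the `q`-expansion `f = f₀ + f₁ q + ⋯ + f_r q ^ r`,
`deg f_i < deg q`, for a monic non-constant `q`. -/
def expCoeff (q f : K[X]) (i : ℕ) : K[X] := ((fun g : K[X] => g /ₘ q)^[i] f) %ₘ q

theorem degree_expCoeff_lt {q : K[X]} (hq : q.Monic) (f : K[X]) (i : ℕ) :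
    (expCoeff q f i).degree < q.degree :=
  degree_modByMonic_lt _ hq

theorem sum_expCoeff {q : K[X]} (hq : q.Monic) (h1 : 0 < q.natDegree) (f : K[X]) (n : ℕ)
    (hn : f.natDegree < n) : f = ∑ i ∈ Finset.range n, expCoeff q f i * q ^ i := by
  induction n generalizing f with
  | zero => omega
  | succ n ih =>
    rw [Finset.sum_range_succ']
    have e : ∀ i, expCoeff q f (i + 1) = expCoeff q (f /ₘ q) i := fun i => by
      simp [expCoeff, Function.iterate_succ_apply]
    have e0 : expCoeff q f 0 = f %ₘ q := rfl
    simp only [e, e0, pow_succ, ← mul_assoc, ← Finset.sum_mul, pow_zero, mul_one]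
    have key : f /ₘ q = ∑ i ∈ Finset.range n, expCoeff q (f /ₘ q) i * q ^ i := by
      rcases Nat.eq_zero_or_pos n with rfl | hpos
      · have : f.natDegree = 0 := by omega
        rw [Finset.sum_range_zero, divByMonic_eq_zero_iff hq]
        exact degree_lt_degree (by omega)
      · exact ih _ (by rw [natDegree_divByMonic _ hq]; omega)
    rw [← key, mul_comm, add_comm]
    exact (modByMonic_add_div f q).symm

end Valuations

/-! ### Newton polygons -/

section Newton

variable {Γ : Type*} [AddCommGroup Γ] [LinearOrder Γ] [IsOrderedAddMonoid Γ] [Module ℚ Γ]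

/-- The convex hull in `ℚ × Γ` of the points lying on or above one of the points `(i, w i)`
with `w i ≠ ∞`. -/
def newtonRegion (w : ℕ → WithTop Γ) : Set (ℚ × Γ) :=
  convexHull ℚ {p : ℚ × Γ | ∃ i : ℕ, p.1 = (i : ℚ) ∧ w i ≤ (p.2 : WithTop Γ)}

/-- The Newton polygon of the points `(i, w i)`, `w i ≠ ∞`: the lower boundary of their convex
hull, that is, the highest convex line that passes through or below all of them. -/
def newtonPolygon (w : ℕ → WithTop Γ) : Set (ℚ × Γ) :=
  {p | p ∈ newtonRegion w ∧ ∀ y : Γ, (p.1, y) ∈ newtonRegion w → p.2 ≤ y}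

/-- The segment joining `(i, w i)` and `(k, w k)` (both values finite) lies on the Newton
polygon. -/
def SegmentOnPolygon (w : ℕ → WithTop Γ) (i k : ℕ) : Prop :=
  ∃ a b : Γ, w i = a ∧ w k = b ∧ segment ℚ ((i : ℚ), a) ((k : ℚ), b) ⊆ newtonPolygon w

/-- `s` is the slope of the first side of the Newton polygon. That side joins `(0, w 0)`, with
`w 0 ≠ ∞`, to `(k, w k)`, where `k > 0` is as large as possible. -/
def IsFirstSlope (w : ℕ → WithTop Γ) (s : Γ) : Prop :=
  ∃ k : ℕ, 0 < k ∧ SegmentOnPolygon w 0 k ∧ (∀ l, SegmentOnPolygon w 0 l → l ≤ k) ∧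
    ∃ a b : Γ, w 0 = a ∧ w k = b ∧ s = (1 / (k : ℚ)) • (b - a)

/-- `s` is the slope of the first side of the Newton polygon of `f` with respect to `q`
and `ν`. -/
def IsFirstSlopeOf {K : Type*} [Field K] (ν : AddValuation K[X] (WithTop Γ)) (q f : K[X])
    (s : Γ) : Prop :=
  IsFirstSlope (fun i => ν (expCoeff q f i)) s

end Newton

end ValApproach

end

/-!
Reduction modulo a key polynomial `Q` of `ν` is a valuation `f ↦ ν (f %ₘ Q)` above `ν`
(`IsKeyPoly.isResidualKey`). Hence for `α > ν Q` the least value `ν (f_i) + i α` of a term of the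
`Q`-expansion defines the augmented valuation `[ν; Q, α]` (`augVal`): leading terms multiply, since
the carry in a product of coefficients has greater value (`IsLead.mul`).

Let `Q ≠ F` and let `-α` be the slope of the first side of the Newton polygon of `F`. The constant
term `f₀` and a later term of the expansion of `F` have the same least value `ν (f₀)` in
`μ = [ν; Q, α]`. This has two consequences.

* The initial form of `F` in `μ` has positive degree in `Q`, so it is not a unit
  (`not_lt_augVal_one_sub_mul`). Then a valuation with support `(F)` lies above `μ`
  (`exists_mem_valsSupp_of_forall_not_lt`): the polynomials of positive value generate a proper
  ideal in the image in `K[x]/(F)` of those of non-negative value, Chevalley's theorem gives a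
  valuation ring, and since `K[x]/(F)` is algebraic over `K` and `Γ` is divisible, the valuation
  extends `ν₀` with values in `Γ` (`exists_addValuation_of_valuationSubring`).
* A valuation with support `(F)` above `μ` agrees with `ν` in degrees less than `deg Q`
  (`map_eq_of_augVal_le`). If it gave `Q` a value greater than `α`, then `f₀` would be the only
  term of least value and `F` would have the finite value `ν (f₀)`
  (`map_self_eq_of_augVal_le`).

That `ν Q < α` holds because the initial form of `Q` divides that of `F`: the remainder `f₀` has
value greater than `ν F`, so another term has value less than `ν (f₀)`
(`IsKeyPoly.exists_term_lt`). If `Q = F`, any valuation of support `(F)` above `ν` will do.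
-/

noncomputable section

open Polynomial

namespace ValApproach

/-! ### Divisibility of initial forms -/

section Graded

variable {Γ : Type*} [AddCommGroup Γ] [LinearOrder Γ] [IsOrderedAddMonoid Γ]
variable {R : Type*} [CommRing R] {ν : AddValuation R (WithTop Γ)}

theorem initialForm_eq_of {a : R} {γ : Γ} (h : ν a = γ) :
    initialForm ν a = DirectSum.of (GrComp ν) γ (grMk ν γ a h.ge) := by
  have hne : ν a ≠ ⊤ := by simp [h]
  have hγ : (ν a).untop hne = γ := by simp [h]
  rw [initialForm, dif_neg hne]
  subst hγ
  rfl

theorem of_grMk_eq_iff {γ : Γ} {a b : R} {ha hb} :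
    DirectSum.of (GrComp ν) γ (grMk ν γ a ha) = DirectSum.of (GrComp ν) γ (grMk ν γ b hb) ↔
      (γ : WithTop Γ) < ν (b - a) :=
  (DirectSum.of_injective γ).eq_iff.trans grMk_eq_iff

theorem initialForm_mul {a b : R} (ha : ν a ≠ ⊤) (hb : ν b ≠ ⊤) :
    initialForm ν (a * b) = initialForm ν a * initialForm ν b := by
  obtain ⟨γ, hγ⟩ := WithTop.ne_top_iff_exists.1 ha
  obtain ⟨δ, hδ⟩ := WithTop.ne_top_iff_exists.1 hb
  have hab : ν (a * b) = ((γ + δ : Γ) : WithTop Γ) := by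
    rw [ν.map_mul, ← hγ, ← hδ, WithTop.coe_add]
  rw [initialForm_eq_of hγ.symm, initialForm_eq_of hδ.symm, initialForm_eq_of hab,
    DirectSum.of_mul_of]
  rfl

theorem initialForm_one : initialForm ν (1 : R) = 1 :=
  initialForm_eq_of (γ := 0) (by simp)

theorem of_mul_apply {γ δ : Γ} (x : GrComp ν γ) (y : Gr ν) :
    (DirectSum.of (GrComp ν) γ x * y) (γ + δ) = grMul x (y δ) := by
  induction y using DirectSum.induction_on with
  | zero =>
    rw [mul_zero]
    exact (DirectSum.GNonUnitalNonAssocSemiring.mul_zero (A := GrComp ν) x).symm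
  | of ε b =>
    rw [DirectSum.of_mul_of]
    rcases eq_or_ne ε δ with rfl | h
    · rw [DirectSum.of_eq_same, DirectSum.of_eq_same]
      rfl
    · rw [DirectSum.of_eq_of_ne _ _ _ (by simpa using h.symm),
        DirectSum.of_eq_of_ne _ _ _ h.symm]
      exact (DirectSum.GNonUnitalNonAssocSemiring.mul_zero (A := GrComp ν) x).symm
  | add y z hy hz =>
    rw [mul_add, DirectSum.add_apply, DirectSum.add_apply, hy, hz]
    exact (DirectSum.GNonUnitalNonAssocSemiring.mul_add (A := GrComp ν) x _ _).symm

/-- Divisibility of initial forms, expressed in the ring: a quotient may be taken homogeneous,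
and then lifted. -/
theorem initialForm_dvd_iff {q f : R} (hq : ν q ≠ ⊤) (hf : ν f ≠ ⊤) :
    initialForm ν q ∣ initialForm ν f ↔ ∃ h, ν f < ν (f - q * h) := by
  obtain ⟨γ, hγ⟩ := WithTop.ne_top_iff_exists.1 hq
  obtain ⟨δ, hδ⟩ := WithTop.ne_top_iff_exists.1 hf
  constructor
  · rintro ⟨y, hy⟩
    obtain ⟨ε, rfl⟩ : ∃ ε, δ = γ + ε := ⟨δ - γ, by abel⟩
    rw [initialForm_eq_of hδ.symm, initialForm_eq_of hγ.symm] at hy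
    have hc := congrArg (fun z : Gr ν => z (γ + ε)) hy
    simp only [of_mul_apply, DirectSum.of_eq_same] at hc
    obtain ⟨h, hh, e⟩ := grMk_surj (y ε)
    rw [e, grMul_mk, grMk_eq_iff] at hc
    refine ⟨h, ?_⟩
    rwa [← hδ, ν.map_sub_swap]
  · rintro ⟨h, hh⟩
    have hqh : ν (q * h) = ν f := ν.map_eq_of_lt_sub (by rwa [ν.map_sub_swap])
    have hh0 : ν h ≠ ⊤ := by
      intro h0
      rw [ν.map_mul, h0, add_top] at hqh
      exact hf hqh.symm
    refine ⟨initialForm ν h, ?_⟩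
    rw [← initialForm_mul hq hh0, initialForm_eq_of hδ.symm,
      initialForm_eq_of (hqh.trans hδ.symm), of_grMk_eq_iff, ν.map_sub_swap, hδ]
    exact hh

end Graded

/-! ### Key polynomials through division with remainder -/

section Residual

variable {Γ : Type*} [AddCommGroup Γ] [LinearOrder Γ] [IsOrderedAddMonoid Γ]
variable {K : Type*} [Field K]

/-- The properties of a key polynomial `Q` on which augmentation rests: `ν` has trivial support,
and `f ↦ ν (f %ₘ Q)` is a valuation above `ν`. -/
structure IsResidualKey (ν : AddValuation K[X] (WithTop Γ)) (Q : K[X]) : Prop where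
  monic : Q.Monic
  natDegree_pos : 0 < Q.natDegree
  ne_top : ∀ f, f ≠ 0 → ν f ≠ ⊤
  le_mod : ∀ f, ν f ≤ ν (f %ₘ Q)
  mul_mod : ∀ a b : K[X], a.degree < Q.degree → b.degree < Q.degree →
    ν ((a * b) %ₘ Q) = ν a + ν b

variable {ν : AddValuation K[X] (WithTop Γ)} {Q : K[X]}

theorem IsKeyPoly.map_ne_top (hQ : IsKeyPoly ν Q) : ν Q ≠ ⊤ := fun h =>
  hQ.2.1.ne_zero (by rw [initialForm, dif_pos h])

theorem IsKeyPoly.not_dvd_one (hQ : IsKeyPoly ν Q) : ¬ initialForm ν Q ∣ initialForm ν 1 := by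
  rw [initialForm_one]
  exact fun h => hQ.2.1.not_isUnit (isUnit_of_dvd_one h)

theorem IsKeyPoly.natDegree_pos (hQ : IsKeyPoly ν Q) : 0 < Q.natDegree := by
  refine Nat.pos_of_ne_zero fun h => hQ.not_dvd_one ?_
  rw [eq_one_of_monic_natDegree_zero hQ.1 h]

/-- A valuation that has a key polynomial has trivial support: otherwise its support is a maximal
ideal, `Q` is invertible modulo that ideal, and the initial form of `Q` is a unit. -/
theorem IsKeyPoly.ne_top_of_ne_zero (hQ : IsKeyPoly ν Q) (f : K[X]) (hf : f ≠ 0) : ν f ≠ ⊤ := by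
  intro htop
  have hpr : ν.supp.IsPrime := by
    refine ⟨fun h => ?_, fun {a b} hab => ?_⟩
    · have : (1 : K[X]) ∈ ν.supp := h ▸ Submodule.mem_top
      simp [AddValuation.mem_supp_iff] at this
    · rw [AddValuation.mem_supp_iff, ν.map_mul, WithTop.add_eq_top] at hab
      simpa [AddValuation.mem_supp_iff] using hab
  have hmax : ν.supp.IsMaximal := by
    refine IsPrime.to_maximal_ideal fun h => hf ?_
    rw [← Ideal.mem_bot, ← h, AddValuation.mem_supp_iff, htop]
  have hQs : Q ∉ ν.supp := fun h => hQ.map_ne_top ((ν.mem_supp_iff Q).1 h)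
  obtain ⟨g, s, hs, e⟩ := hmax.exists_inv hQs
  refine hQ.not_dvd_one ((initialForm_dvd_iff hQ.map_ne_top (by simp)).2 ⟨g, ?_⟩)
  have : (1 : K[X]) - Q * g = s := by rw [← e]; ring
  rw [this, (ν.mem_supp_iff s).1 hs, ν.map_one]
  exact WithTop.coe_lt_top 0

theorem IsKeyPoly.isResidualKey (hQ : IsKeyPoly ν Q) : IsResidualKey ν Q := by
  have hν := hQ.ne_top_of_ne_zero
  -- a non-zero polynomial of smaller degree is not divisible by `Q` up to higher order
  have hmin : ∀ a h : K[X], a ≠ 0 → a.degree < Q.degree → ¬ ν a < ν (a - Q * h) := by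
    intro a h ha hdeg hlt
    have := hQ.2.2 a ha ((initialForm_dvd_iff hQ.map_ne_top (hν a ha)).2 ⟨h, hlt⟩)
    exact absurd (natDegree_lt_natDegree ha hdeg) (by omega)
  have hle : ∀ f, ν f ≤ ν (f %ₘ Q) := by
    intro f
    by_contra! hlt
    refine hmin (f %ₘ Q) (-(f /ₘ Q)) ?_ (degree_modByMonic_lt f hQ.1) ?_
    · intro h0
      simp [h0] at hlt
    · rwa [mul_neg, sub_neg_eq_add, modByMonic_add_div]
  refine ⟨hQ.1, hQ.natDegree_pos, hν, hle, fun a b ha hb => ?_⟩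
  rcases eq_or_ne a 0 with rfl | ha0
  · simp
  rcases eq_or_ne b 0 with rfl | hb0
  · simp
  rw [← ν.map_mul]
  refine (hle _).antisymm' (not_lt.1 fun hlt => ?_)
  have hdvd : initialForm ν Q ∣ initialForm ν (a * b) := by
    refine (initialForm_dvd_iff hQ.map_ne_top (hν _ (mul_ne_zero ha0 hb0))).2
      ⟨(a * b) /ₘ Q, ?_⟩
    rwa [← modByMonic_eq_sub_mul_div]
  rw [initialForm_mul (hν a ha0) (hν b hb0)] at hdvd
  rcases hQ.2.1.dvd_or_dvd hdvd with h | h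
  · obtain ⟨g, hg⟩ := (initialForm_dvd_iff hQ.map_ne_top (hν a ha0)).1 h
    exact hmin a g ha0 ha hg
  · obtain ⟨g, hg⟩ := (initialForm_dvd_iff hQ.map_ne_top (hν b hb0)).1 h
    exact hmin b g hb0 hb hg

end Residual

/-! ### Expansions in powers of a monic polynomial -/

section Expansion

variable {K : Type*} [Field K] {q : K[X]}

theorem expCoeff_zero_right (f : K[X]) : expCoeff q f 0 = f %ₘ q := rfl

theorem expCoeff_succ (f : K[X]) (i : ℕ) : expCoeff q f (i + 1) = expCoeff q (f /ₘ q) i := by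
  simp [expCoeff, Function.iterate_succ_apply]

theorem add_divByMonic (hq : q.Monic) (f g : K[X]) : (f + g) /ₘ q = f /ₘ q + g /ₘ q := by
  refine (div_modByMonic_unique _ (f %ₘ q + g %ₘ q) hq ⟨?_, ?_⟩).1
  · rw [mul_add, add_add_add_comm, modByMonic_add_div, modByMonic_add_div]
  · exact (degree_add_le _ _).trans_lt
      (max_lt (degree_modByMonic_lt _ hq) (degree_modByMonic_lt _ hq))

theorem expCoeff_add (hq : q.Monic) (f g : K[X]) (i : ℕ) :
    expCoeff q (f + g) i = expCoeff q f i + expCoeff q g i := by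
  induction i generalizing f g with
  | zero => simp only [expCoeff_zero_right, add_modByMonic]
  | succ i ih => simp only [expCoeff_succ, add_divByMonic hq, ih]

theorem expCoeff_zero_left (i : ℕ) : expCoeff q 0 i = 0 := by
  induction i with
  | zero => simp [expCoeff_zero_right]
  | succ i ih => rw [expCoeff_succ, zero_divByMonic, ih]

theorem expCoeff_neg (hq : q.Monic) (f : K[X]) (i : ℕ) :
    expCoeff q (-f) i = -expCoeff q f i := by
  rw [eq_neg_iff_add_eq_zero, ← expCoeff_add hq, neg_add_cancel, expCoeff_zero_left]

theorem expCoeff_eq_zero (hq : q.Monic) (h1 : 0 < q.natDegree) {f : K[X]} {i : ℕ}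
    (hi : f.natDegree < i) : expCoeff q f i = 0 := by
  induction i generalizing f with
  | zero => omega
  | succ i ih =>
    rw [expCoeff_succ]
    by_cases hf : f.natDegree < q.natDegree
    · rw [(divByMonic_eq_zero_iff hq).2 (degree_lt_degree hf), expCoeff_zero_left]
    · exact ih (by rw [natDegree_divByMonic _ hq]; omega)

theorem expCoeff_mul_pow (hq : q.Monic) {a : K[X]} (ha : a.degree < q.degree) (n i : ℕ) :
    expCoeff q (a * q ^ n) i = if i = n then a else 0 := by
  induction n generalizing i with
  | zero =>
    rw [pow_zero, mul_one]
    cases i with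
    | zero => rw [if_pos rfl, expCoeff_zero_right, (modByMonic_eq_self_iff hq).2 ha]
    | succ i =>
      rw [if_neg (by omega), expCoeff_succ, (divByMonic_eq_zero_iff hq).2 ha,
        expCoeff_zero_left]
  | succ n ih =>
    have e : a * q ^ (n + 1) = q * (a * q ^ n) := by ring
    rw [e]
    cases i with
    | zero => rw [if_neg (by omega), expCoeff_zero_right, self_mul_modByMonic hq]
    | succ i => simp only [expCoeff_succ, mul_divByMonic_cancel_left _ hq, ih, Nat.succ_inj]

theorem degree_divByMonic_mul_lt (hq : q.Monic) {a b : K[X]} (ha : a.degree < q.degree)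
    (hb : b.degree < q.degree) : ((a * b) /ₘ q).degree < q.degree := by
  rcases eq_or_ne ((a * b) /ₘ q) 0 with h | h
  · rw [h, degree_zero]
    exact bot_lt_iff_ne_bot.2 (by simpa using hq.ne_zero)
  have ha0 : a ≠ 0 := by rintro rfl; simp at h
  have hb0 : b ≠ 0 := by rintro rfl; simp at h
  have h1 := natDegree_lt_natDegree ha0 ha
  have h2 := natDegree_lt_natDegree hb0 hb
  refine degree_lt_degree ?_
  rw [natDegree_divByMonic _ hq, natDegree_mul ha0 hb0]
  omega

theorem exists_expCoeff_ne_zero (hq : q.Monic) (h1 : 0 < q.natDegree) {f : K[X]} (hf : f ≠ 0) :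
    ∃ i, expCoeff q f i ≠ 0 := by
  by_contra! h
  refine hf ?_
  rw [sum_expCoeff hq h1 f _ (Nat.lt_succ_self _)]
  exact Finset.sum_eq_zero fun i _ => by rw [h i, zero_mul]

end Expansion

/-! ### Augmentation of a valuation -/

section Augmentation

variable {Γ : Type*} [AddCommGroup Γ] [LinearOrder Γ] [IsOrderedAddMonoid Γ]
variable {K : Type*} [Field K]

theorem coe_add_lt_add_of_lt_of_le {A B : Γ} {x y : WithTop Γ} (hx : (A : WithTop Γ) < x)
    (hy : (B : WithTop Γ) ≤ y) : ((A + B : Γ) : WithTop Γ) < x + y := by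
  rw [WithTop.coe_add]
  exact (WithTop.add_lt_add_right WithTop.coe_ne_top hx).trans_le (by gcongr)

theorem coe_add_lt_add_of_le_of_lt {A B : Γ} {x y : WithTop Γ} (hx : (A : WithTop Γ) ≤ x)
    (hy : (B : WithTop Γ) < y) : ((A + B : Γ) : WithTop Γ) < x + y := by
  rw [add_comm A, add_comm x]
  exact coe_add_lt_add_of_lt_of_le hy hx

/-- The value `ν (f_i) + i α` that the augmentation gives to the `i`-th term of the
`Q`-expansion of `f`. -/
def termVal (ν : AddValuation K[X] (WithTop Γ)) (Q : K[X]) (α : Γ) (f : K[X]) (i : ℕ) :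
    WithTop Γ :=
  ν (expCoeff Q f i) + ((i • α : Γ) : WithTop Γ)

/-- The augmentation `[ν; Q, α]` as a function: the least value of a term of the
`Q`-expansion. -/
def augFun (ν : AddValuation K[X] (WithTop Γ)) (Q : K[X]) (α : Γ) (f : K[X]) : WithTop Γ :=
  (Finset.range (f.natDegree + 1)).inf (termVal ν Q α f)

/-- All terms of the `Q`-expansion of `f` have value at least `A`, and those in degree `≥ n` in
`Q` have value greater than `A`. -/
def TermsGE (ν : AddValuation K[X] (WithTop Γ)) (Q : K[X]) (α A : Γ) (n : ℕ) (f : K[X]) : Prop :=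
  ∀ i, (A : WithTop Γ) ≤ termVal ν Q α f i ∧ (n ≤ i → (A : WithTop Γ) < termVal ν Q α f i)

/-- `A` is the least value of a term of the `Q`-expansion of `f`, and `n` is the largest index
at which it occurs: the degree in `Q` of the initial form of `f`. -/
def IsLead (ν : AddValuation K[X] (WithTop Γ)) (Q : K[X]) (α A : Γ) (n : ℕ) (f : K[X]) : Prop :=
  TermsGE ν Q α A (n + 1) f ∧ termVal ν Q α f n = A

variable {ν : AddValuation K[X] (WithTop Γ)} {Q : K[X]} {α A B : Γ} {m n : ℕ} {f g : K[X]}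

theorem termVal_add_ge (hQ : Q.Monic) (f g : K[X]) (i : ℕ) :
    min (termVal ν Q α f i) (termVal ν Q α g i) ≤ termVal ν Q α (f + g) i := by
  simp only [termVal, expCoeff_add hQ]
  rw [min_add_add_right]
  gcongr
  exact ν.map_add _ _

theorem termVal_neg (hQ : Q.Monic) (f : K[X]) (i : ℕ) :
    termVal ν Q α (-f) i = termVal ν Q α f i := by
  simp only [termVal, expCoeff_neg hQ, ν.map_neg]

theorem termVal_mul_pow (hQ : Q.Monic) {a : K[X]} (ha : a.degree < Q.degree) (n i : ℕ) :
    termVal ν Q α (a * Q ^ n) i = if i = n then ν a + ((n • α : Γ) : WithTop Γ) else ⊤ := by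
  rw [termVal, expCoeff_mul_pow hQ ha]
  split_ifs with h
  · rw [h]
  · simp

theorem TermsGE.add (hQ : Q.Monic) (hf : TermsGE ν Q α A n f) (hg : TermsGE ν Q α A n g) :
    TermsGE ν Q α A n (f + g) := fun i =>
  ⟨(le_min (hf i).1 (hg i).1).trans (termVal_add_ge hQ f g i),
    fun h => (lt_min ((hf i).2 h) ((hg i).2 h)).trans_le (termVal_add_ge hQ f g i)⟩

theorem TermsGE.zero : TermsGE ν Q α A n 0 := fun i => by
  simp [termVal, expCoeff_zero_left]

theorem TermsGE.sum (hQ : Q.Monic) {ι : Type*} (s : Finset ι) {F : ι → K[X]}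
    (h : ∀ i ∈ s, TermsGE ν Q α A n (F i)) : TermsGE ν Q α A n (∑ i ∈ s, F i) :=
  Finset.sum_induction _ _ (fun _ _ => TermsGE.add hQ) TermsGE.zero h

theorem termsGE_mul_pow (hQ : Q.Monic) {a : K[X]} (ha : a.degree < Q.degree)
    (h : (A : WithTop Γ) ≤ ν a + ((m • α : Γ) : WithTop Γ))
    (h' : n ≤ m → (A : WithTop Γ) < ν a + ((m • α : Γ) : WithTop Γ)) :
    TermsGE ν Q α A n (a * Q ^ m) := fun i => by
  rw [termVal_mul_pow hQ ha]
  split_ifs with hi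
  · exact ⟨h, fun hn => h' (hi ▸ hn)⟩
  · simp

/-- In a product `a Q ^ i * b Q ^ j`, the quotient of `a * b` by `Q` contributes a term of value
greater than the sum of the values of the factors, because `Q` has gained value. -/
theorem lt_carry (hQ : IsResidualKey ν Q) (hα : ν Q < α) {a b : K[X]} {i j : ℕ}
    (ha : (A : WithTop Γ) ≤ ν a + ((i • α : Γ) : WithTop Γ))
    (hb : (B : WithTop Γ) ≤ ν b + ((j • α : Γ) : WithTop Γ)) :
    ((A + B : Γ) : WithTop Γ) < ν ((a * b) /ₘ Q) + (((i + j + 1) • α : Γ) : WithTop Γ) := by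
  set c := (a * b) /ₘ Q with hc
  rcases eq_or_ne c 0 with h0 | h0
  · rw [h0, ν.map_zero, top_add]
    exact WithTop.coe_lt_top _
  have hle : ν (a * b) ≤ ν (Q * c) := by
    have e : Q * c = a * b - (a * b) %ₘ Q := by
      rw [modByMonic_eq_sub_mul_div]; ring
    rw [e]
    exact ν.map_le_sub le_rfl (hQ.le_mod _)
  obtain ⟨γ, hγ⟩ := WithTop.ne_top_iff_exists.1 (hQ.ne_top c h0)
  calc ((A + B : Γ) : WithTop Γ)
      ≤ (ν a + ((i • α : Γ) : WithTop Γ)) + (ν b + ((j • α : Γ) : WithTop Γ)) := by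
        rw [WithTop.coe_add]; gcongr
    _ = ν (a * b) + (((i + j) • α : Γ) : WithTop Γ) := by
        rw [add_smul, WithTop.coe_add, ν.map_mul]; abel
    _ ≤ ν (Q * c) + (((i + j) • α : Γ) : WithTop Γ) := by gcongr
    _ = ν Q + ((γ + (i + j) • α : Γ) : WithTop Γ) := by
        rw [ν.map_mul, ← hγ, add_assoc, WithTop.coe_add]
    _ < α + ((γ + (i + j) • α : Γ) : WithTop Γ) :=
        WithTop.add_lt_add_right WithTop.coe_ne_top hα
    _ = ν c + (((i + j + 1) • α : Γ) : WithTop Γ) := by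
        rw [← hγ, ← WithTop.coe_add, ← WithTop.coe_add]
        congr 1
        rw [add_smul (i + j) 1, one_smul]; abel

theorem mul_pow_eq (a b : K[X]) (i j : ℕ) :
    (a * Q ^ i) * (b * Q ^ j) =
      ((a * b) %ₘ Q) * Q ^ (i + j) + ((a * b) /ₘ Q) * Q ^ (i + j + 1) := by
  conv_lhs => rw [show (a * Q ^ i) * (b * Q ^ j) = (a * b) * Q ^ (i + j) by ring,
    ← modByMonic_add_div (a * b) Q]
  ring

/-- The index bounds are those for which `i + j ≥ n + m` forces `i ≥ n` or `j ≥ m + 1`. -/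
theorem TermsGE.mul (hQ : IsResidualKey ν Q) (hα : ν Q < α) (hf : TermsGE ν Q α A n f)
    (hg : TermsGE ν Q α B (m + 1) g) : TermsGE ν Q α (A + B) (n + m) (f * g) := by
  conv => arg 6; rw [sum_expCoeff hQ.monic hQ.natDegree_pos f _ (Nat.lt_succ_self _),
    sum_expCoeff hQ.monic hQ.natDegree_pos g _ (Nat.lt_succ_self _), Finset.sum_mul_sum]
  refine TermsGE.sum hQ.monic _ fun i _ => TermsGE.sum hQ.monic _ fun j _ => ?_
  have ha := degree_expCoeff_lt hQ.monic f i
  have hb := degree_expCoeff_lt hQ.monic g j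
  have hd := hQ.mul_mod _ _ ha hb
  have hcarry := lt_carry hQ hα (hf i).1 (hg j).1
  have hv : ν ((expCoeff Q f i * expCoeff Q g j) %ₘ Q) + (((i + j) • α : Γ) : WithTop Γ) =
      termVal ν Q α f i + termVal ν Q α g j := by
    rw [hd, add_smul, WithTop.coe_add, termVal, termVal]; abel
  rw [mul_pow_eq]
  refine TermsGE.add hQ.monic (termsGE_mul_pow hQ.monic (degree_modByMonic_lt _ hQ.monic) ?_ ?_)
    (termsGE_mul_pow hQ.monic (degree_divByMonic_mul_lt hQ.monic ha hb) hcarry.le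
      fun _ => hcarry)
  · rw [hv, WithTop.coe_add]
    exact add_le_add (hf i).1 (hg j).1
  · intro h
    rw [hv]
    rcases le_or_gt n i with hi | hi
    · exact coe_add_lt_add_of_lt_of_le ((hf i).2 hi) (hg j).1
    · exact coe_add_lt_add_of_le_of_lt (hf i).1 ((hg j).2 (by omega))

theorem IsLead.sub_lead (hQ : Q.Monic) (hf : IsLead ν Q α A n f) :
    TermsGE ν Q α A n (f - expCoeff Q f n * Q ^ n) := fun i => by
  rw [termVal, sub_eq_add_neg, expCoeff_add hQ, expCoeff_neg hQ,
    expCoeff_mul_pow hQ (degree_expCoeff_lt hQ f n)]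
  split_ifs with hi
  · simp [hi]
  · rw [neg_zero, add_zero]
    exact ⟨(hf.1 i).1, fun h => (hf.1 i).2 (by omega)⟩

/-- Initial forms multiply like polynomials in `Q`: leading terms have a product that is the
leading term of the product. -/
theorem IsLead.mul (hQ : IsResidualKey ν Q) (hα : ν Q < α) (hf : IsLead ν Q α A n f)
    (hg : IsLead ν Q α B m g) : IsLead ν Q α (A + B) (n + m) (f * g) := by
  refine ⟨by simpa only [add_right_comm] using TermsGE.mul hQ hα hf.1 hg.1, ?_⟩
  have hm := hQ.monic
  have ha := degree_expCoeff_lt hm f n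
  have hb := degree_expCoeff_lt hm g m
  have hb' : TermsGE ν Q α A (n + 1) (expCoeff Q f n * Q ^ n) :=
    termsGE_mul_pow hm ha (hf.1 n).1 fun h => absurd h (by omega)
  have h1 : TermsGE ν Q α (A + B) (n + m) ((f - expCoeff Q f n * Q ^ n) * g) :=
    TermsGE.mul hQ hα (hf.sub_lead hm) hg.1
  have h2 : TermsGE ν Q α (A + B) (n + m)
      ((expCoeff Q f n * Q ^ n) * (g - expCoeff Q g m * Q ^ m)) := by
    rw [mul_comm, add_comm A, add_comm n]
    exact TermsGE.mul hQ hα (hg.sub_lead hm) hb'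
  have hcarry := lt_carry hQ hα (hf.1 n).1 (hg.1 m).1
  have h3 : TermsGE ν Q α (A + B) (n + m)
      (((expCoeff Q f n * expCoeff Q g m) /ₘ Q) * Q ^ (n + m + 1)) :=
    termsGE_mul_pow hm (degree_divByMonic_mul_lt hm ha hb) hcarry.le fun _ => hcarry
  have hlt := (((h1.add hm h2).add hm h3) (n + m)).2 le_rfl
  have e : f * g = ((f - expCoeff Q f n * Q ^ n) * g +
      (expCoeff Q f n * Q ^ n) * (g - expCoeff Q g m * Q ^ m) +
      ((expCoeff Q f n * expCoeff Q g m) /ₘ Q) * Q ^ (n + m + 1)) +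
      ((expCoeff Q f n * expCoeff Q g m) %ₘ Q) * Q ^ (n + m) := by
    have := mul_pow_eq (Q := Q) (expCoeff Q f n) (expCoeff Q g m) n m
    linear_combination this
  have hmain : ν ((expCoeff Q f n * expCoeff Q g m) %ₘ Q) +
      (((n + m) • α : Γ) : WithTop Γ) = ((A + B : Γ) : WithTop Γ) := by
    rw [hQ.mul_mod _ _ ha hb, WithTop.coe_add, ← hf.2, ← hg.2, termVal, termVal, add_smul,
      WithTop.coe_add]
    abel
  set s := (f - expCoeff Q f n * Q ^ n) * g +
      (expCoeff Q f n * Q ^ n) * (g - expCoeff Q g m * Q ^ m) +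
      ((expCoeff Q f n * expCoeff Q g m) /ₘ Q) * Q ^ (n + m + 1)
  rw [e, ← hmain]
  rw [← hmain, termVal] at hlt
  rw [termVal, expCoeff_add hm, expCoeff_mul_pow hm (degree_modByMonic_lt _ hm), if_pos rfl,
    ν.map_add_eq_of_lt_right (lt_of_add_lt_add_right hlt)]

theorem IsLead.unique {A' : Γ} {n' : ℕ} (h : IsLead ν Q α A n f) (h' : IsLead ν Q α A' n' f) :
    A = A' ∧ n = n' := by
  have hA : A = A' := le_antisymm (WithTop.coe_le_coe.1 (h'.2 ▸ (h.1 n').1))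
    (WithTop.coe_le_coe.1 (h.2 ▸ (h'.1 n).1))
  subst hA
  refine ⟨rfl, le_antisymm ?_ ?_⟩ <;> by_contra! hlt
  · exact ((h'.1 n).2 (by omega)).ne' h.2
  · exact ((h.1 n').2 (by omega)).ne' h'.2

theorem le_augFun_iff (hQ : Q.Monic) (h1 : 0 < Q.natDegree) {a : WithTop Γ} :
    a ≤ augFun ν Q α f ↔ ∀ i, a ≤ termVal ν Q α f i := by
  rw [augFun, Finset.le_inf_iff]
  refine ⟨fun h i => ?_, fun h i _ => h i⟩
  by_cases hi : i < f.natDegree + 1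
  · exact h i (Finset.mem_range.2 hi)
  · rw [termVal, expCoeff_eq_zero hQ h1 (by omega), ν.map_zero, top_add]
    exact le_top

theorem IsLead.augFun_eq (hQ : Q.Monic) (h1 : 0 < Q.natDegree) (h : IsLead ν Q α A n f) :
    augFun ν Q α f = A :=
  le_antisymm (h.2 ▸ (le_augFun_iff hQ h1).1 le_rfl n)
    ((le_augFun_iff hQ h1).2 fun i => (h.1 i).1)

theorem exists_isLead (hQ : IsResidualKey ν Q) (hf : f ≠ 0) :
    ∃ A n, IsLead ν Q α A n f := by
  obtain ⟨i₀, hi₀⟩ := exists_expCoeff_ne_zero hQ.monic hQ.natDegree_pos hf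
  have hle := (le_augFun_iff (ν := ν) (α := α) (f := f) hQ.monic hQ.natDegree_pos).1 le_rfl
  have hfin : termVal ν Q α f i₀ ≠ ⊤ :=
    WithTop.add_ne_top.2 ⟨hQ.ne_top _ hi₀, WithTop.coe_ne_top⟩
  obtain ⟨A, hA⟩ := WithTop.ne_top_iff_exists.1 (ne_top_of_le_ne_top hfin (hle i₀))
  set S := (Finset.range (f.natDegree + 1)).filter fun i => termVal ν Q α f i = A with hS
  have hSne : S.Nonempty := by
    obtain ⟨i, hi, e⟩ := Finset.exists_mem_eq_inf (Finset.range (f.natDegree + 1)) ⟨0, by simp⟩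
      (termVal ν Q α f)
    exact ⟨i, by rw [hS, Finset.mem_filter]; exact ⟨hi, e.symm.trans hA.symm⟩⟩
  refine ⟨A, S.max' hSne, fun i => ⟨hA ▸ hle i, fun hi => ?_⟩,
    (Finset.mem_filter.1 (S.max'_mem hSne)).2⟩
  refine lt_of_le_of_ne (hA ▸ hle i) fun e => ?_
  by_cases hd : i < f.natDegree + 1
  · have := S.le_max' i (by rw [hS, Finset.mem_filter]; exact ⟨Finset.mem_range.2 hd, e.symm⟩)
    omega
  · rw [termVal, expCoeff_eq_zero hQ.monic hQ.natDegree_pos (by omega), ν.map_zero,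
      top_add] at e
    exact WithTop.coe_ne_top e

theorem isLead_of_degree_lt (hQ : Q.Monic) {a : K[X]} (ha : a.degree < Q.degree)
    (hA : ν a = A) : IsLead ν Q α A 0 a := by
  have e := termVal_mul_pow (ν := ν) (α := α) hQ ha 0
  simp only [pow_zero, mul_one, zero_smul, WithTop.coe_zero, add_zero] at e
  refine ⟨fun i => ?_, by rw [e, if_pos rfl, hA]⟩
  rw [e]
  split_ifs with hi
  · exact ⟨hA.ge, fun h => by omega⟩
  · simp

theorem isLead_one (hQ : Q.Monic) (h1 : 0 < Q.natDegree) : IsLead ν Q α 0 0 1 :=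
  isLead_of_degree_lt hQ (by rw [degree_one]; exact natDegree_pos_iff_degree_pos.1 h1) (by simp)

theorem augFun_zero : augFun ν Q α 0 = ⊤ := by
  simp [augFun, termVal, expCoeff_zero_left]

/-- The augmented valuation `[ν; Q, α]`: it sends `f₀ + f₁ Q + ⋯ + f_r Q ^ r` to the least of
the values `ν (f_i) + i α`. -/
def augVal (hQ : IsResidualKey ν Q) (hα : ν Q < α) : AddValuation K[X] (WithTop Γ) :=
  AddValuation.of (augFun ν Q α) augFun_zero
    (by rw [(isLead_one hQ.monic hQ.natDegree_pos).augFun_eq hQ.monic hQ.natDegree_pos]; rfl)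
    (fun f g => (le_augFun_iff hQ.monic hQ.natDegree_pos).2 fun i =>
      (min_le_min ((le_augFun_iff hQ.monic hQ.natDegree_pos).1 le_rfl i)
        ((le_augFun_iff hQ.monic hQ.natDegree_pos).1 le_rfl i)).trans
          (termVal_add_ge hQ.monic f g i))
    (fun f g => by
      rcases eq_or_ne f 0 with rfl | hf
      · rw [zero_mul, augFun_zero, top_add]
      rcases eq_or_ne g 0 with rfl | hg
      · rw [mul_zero, augFun_zero, add_top]
      obtain ⟨A, n, hA⟩ := exists_isLead (α := α) hQ hf
      obtain ⟨B, m, hB⟩ := exists_isLead (α := α) hQ hg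
      rw [hA.augFun_eq hQ.monic hQ.natDegree_pos, hB.augFun_eq hQ.monic hQ.natDegree_pos,
        (hA.mul hQ hα hB).augFun_eq hQ.monic hQ.natDegree_pos, WithTop.coe_add])

theorem augVal_apply (hQ : IsResidualKey ν Q) (hα : ν Q < α) (f : K[X]) :
    augVal hQ hα f = augFun ν Q α f := rfl

theorem le_augVal_iff (hQ : IsResidualKey ν Q) (hα : ν Q < α) {a : WithTop Γ} :
    a ≤ augVal hQ hα f ↔ ∀ i, a ≤ termVal ν Q α f i :=
  le_augFun_iff hQ.monic hQ.natDegree_pos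

theorem augVal_of_degree_lt (hQ : IsResidualKey ν Q) (hα : ν Q < α) {a : K[X]}
    (ha : a.degree < Q.degree) : augVal hQ hα a = ν a := by
  rcases eq_or_ne a 0 with rfl | h0
  · simp
  obtain ⟨A, hA⟩ := WithTop.ne_top_iff_exists.1 (hQ.ne_top a h0)
  rw [augVal_apply, (isLead_of_degree_lt hQ.monic ha hA.symm).augFun_eq hQ.monic
    hQ.natDegree_pos, hA]

theorem augVal_self (hQ : IsResidualKey ν Q) (hα : ν Q < α) : augVal hQ hα Q = α := by
  have h1 : (1 : K[X]).degree < Q.degree := by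
    rw [degree_one]; exact natDegree_pos_iff_degree_pos.1 hQ.natDegree_pos
  have e := termVal_mul_pow (ν := ν) (α := α) hQ.monic h1 1
  simp only [pow_one, one_mul, ν.map_one, zero_add, one_smul] at e
  refine le_antisymm ?_ ((le_augVal_iff hQ hα).2 fun i => ?_)
  · have := (le_augVal_iff hQ hα).1 (le_refl (augVal hQ hα Q)) 1
    rwa [e, if_pos rfl] at this
  · rw [e]
    split_ifs
    exacts [le_rfl, le_top]

/-- If the initial form of `F` has positive degree in `Q`, then it is not a unit. -/
theorem not_lt_augVal_one_sub_mul (hQ : IsResidualKey ν Q) (hα : ν Q < α)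
    (hF : IsLead ν Q α A n f) (hn : 0 < n) (g : K[X]) : ¬ 0 < augVal hQ hα (1 - f * g) := by
  intro hpos
  have hm := hQ.monic
  have hg : g ≠ 0 := by
    rintro rfl
    rw [mul_zero, sub_zero, AddValuation.map_one] at hpos
    exact hpos.false
  obtain ⟨B, m, hB⟩ := exists_isLead (α := α) hQ hg
  have hone : IsLead ν Q α 0 0 1 := isLead_one hm hQ.natDegree_pos
  have hterm : ∀ i, 0 < termVal ν Q α (-(1 - f * g)) i := fun i => by
    rw [termVal_neg hm]
    exact hpos.trans_le ((le_augVal_iff hQ hα).1 le_rfl i)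
  have e : f * g = 1 + -(1 - f * g) := by ring
  have hfg : IsLead ν Q α 0 0 (f * g) := by
    refine ⟨?_, ?_⟩
    · rw [e]
      exact hone.1.add hm fun i => ⟨(hterm i).le, fun _ => hterm i⟩
    · have h0 := hterm 0
      have h1 := hone.2
      simp only [termVal, zero_smul, WithTop.coe_zero, add_zero] at h0 h1 ⊢
      rw [e, expCoeff_add hm, ν.map_add_eq_of_lt_left (by rwa [h1]), h1]
  have := ((hF.mul hQ hα hB).unique hfg).2
  omega

end Augmentation

/-! ### Extension of valuations to algebraic extensions -/

section Extension

variable {Γ : Type*} [AddCommGroup Γ] [LinearOrder Γ] [IsOrderedAddMonoid Γ]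
variable {K : Type*} [Field K] {ν₀ : AddValuation K (WithTop Γ)}

theorem nsmul_le_nsmul_iff_of_pos {n : ℕ} (hn : 0 < n) {x y : Γ} : n • x ≤ n • y ↔ x ≤ y :=
  (nsmul_right_strictMono (M := Γ) hn.ne').le_iff_le

/-- Some positive power of a non-zero element of an algebraic extension has the same value as an
element of the base field: in a vanishing polynomial two terms have equal value. -/
theorem exists_pow_valuation_eq {L : Type*} [Field L] [Algebra K L] [Algebra.IsAlgebraic K L]
    {G : Type*} [LinearOrderedCommGroupWithZero G] (w : Valuation L G) {a : L} (ha : a ≠ 0) :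
    ∃ n : ℕ, 0 < n ∧ ∃ c : K, c ≠ 0 ∧ w a ^ n = w (algebraMap K L c) := by
  classical
  obtain ⟨p, hp0, hp⟩ := Algebra.IsAlgebraic.isAlgebraic (R := K) a
  set t : ℕ → L := fun i => algebraMap K L (p.coeff i) * a ^ i with ht
  have ht0 : ∀ i ∈ p.support, w (t i) ≠ 0 := fun i hi => by
    rw [Valuation.ne_zero_iff]
    exact mul_ne_zero (by simpa using mem_support_iff.1 hi) (pow_ne_zero _ ha)
  have hsum : ∑ i ∈ p.support, t i = 0 := by
    rw [← hp, aeval_eq_sum_range, eq_comm]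
    rw [← Finset.sum_subset (s₁ := p.support)]
    · exact Finset.sum_congr rfl fun i _ => Algebra.smul_def _ _
    · intro i hi
      exact Finset.mem_range.2 (Nat.lt_succ_of_le (le_natDegree_of_mem_supp i hi))
    · intro i _ hi
      rw [notMem_support_iff.1 hi, zero_smul]
  obtain ⟨j, hj, hmax⟩ := p.support.exists_max_image (fun i => w (t i))
    (nonempty_support_iff.2 hp0)
  obtain ⟨i, hi, hij, e⟩ : ∃ i ∈ p.support, i ≠ j ∧ w (t i) = w (t j) := by
    by_contra! h
    refine ht0 j hj ?_
    rw [← Valuation.map_sum_eq_of_lt w hj fun i hi => ?_, hsum, map_zero]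
    obtain ⟨hi, hij⟩ := Finset.mem_sdiff.1 hi
    exact lt_of_le_of_ne (hmax i hi) (h i hi (by simpa using hij))
  have key : ∀ i j : ℕ, i < j → i ∈ p.support → j ∈ p.support → w (t i) = w (t j) →
      ∃ n : ℕ, 0 < n ∧ ∃ c : K, c ≠ 0 ∧ w a ^ n = w (algebraMap K L c) := by
    intro i j hij hi hj e
    have hi' := mem_support_iff.1 hi
    have hj' := mem_support_iff.1 hj
    refine ⟨j - i, by omega, p.coeff i / p.coeff j, div_ne_zero hi' hj', ?_⟩
    have ha' : w a ^ i ≠ 0 := pow_ne_zero _ ((Valuation.ne_zero_iff w).2 ha)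
    have hc : w (algebraMap K L (p.coeff j)) ≠ 0 :=
      (Valuation.ne_zero_iff w).2 (by simpa using hj')
    simp only [ht, map_mul, map_pow] at e
    rw [map_div₀, map_div₀, eq_div_iff hc]
    refine mul_right_cancel₀ ha' ?_
    rw [e, mul_right_comm, ← pow_add, Nat.sub_add_cancel hij.le, mul_comm]
  rcases lt_or_gt_of_ne hij with h | h
  · exact key i j h hi hj e
  · exact key j i h hj hi e.symm

/-- A valuation ring of an algebraic extension `L` of `K` lying over the valuation ring of `ν₀`
is the ring of a valuation of `L` that extends `ν₀` and has values in the divisible group `Γ`. -/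
theorem exists_addValuation_of_valuationSubring [Module ℚ Γ] {L : Type*} [Field L] [Algebra K L]
    [Algebra.IsAlgebraic K L] (V : ValuationSubring L)
    (hV : ∀ c : K, algebraMap K L c ∈ V ↔ 0 ≤ ν₀ c) :
    ∃ v : AddValuation L (WithTop Γ), (∀ c, v (algebraMap K L c) = ν₀ c) ∧
      ∀ a, 0 ≤ v a ↔ a ∈ V := by
  classical
  set w := V.valuation with hw
  have hK : ∀ c d : K, d ≠ 0 → (w (algebraMap K L c) ≤ w (algebraMap K L d) ↔ ν₀ d ≤ ν₀ c) := by
    intro c d hd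
    have hwd : 0 < w (algebraMap K L d) := zero_lt_iff.2
      ((Valuation.ne_zero_iff w).2 (by simpa using hd))
    have hc : c = d * (c / d) := by field_simp
    have e1 : ν₀ c = ν₀ d + ν₀ (c / d) := by rw [← ν₀.map_mul, ← hc]
    obtain ⟨δ, hδ⟩ := WithTop.ne_top_iff_exists.1 (ν₀.ne_top_iff.2 hd)
    rw [← div_le_one₀ hwd, ← map_div₀, ← map_div₀, hw, V.valuation_le_one_iff, hV, e1, ← hδ]
    constructor
    · intro h
      exact le_add_of_nonneg_right h
    · intro h
      exact WithTop.le_of_add_le_add_left (WithTop.coe_ne_top (a := δ)) (by rwa [add_zero])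
  -- `γ` is the value of `a`, computed from a power of `a` that is a unit multiple of a constant
  let rel : L → Γ → Prop := fun a γ => ∃ n : ℕ, 0 < n ∧ ∃ c : K, c ≠ 0 ∧
    w a ^ n = w (algebraMap K L c) ∧ ν₀ c = ((n • γ : Γ) : WithTop Γ)
  have hex : ∀ a, a ≠ 0 → ∃ γ, rel a γ := by
    intro a ha
    obtain ⟨n, hn, c, hc, e⟩ := exists_pow_valuation_eq (K := K) w ha
    obtain ⟨δ, hδ⟩ := WithTop.ne_top_iff_exists.1 (ν₀.ne_top_iff.2 hc)
    refine ⟨(1 / (n : ℚ)) • δ, n, hn, c, hc, e, ?_⟩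
    rw [← hδ, ← Nat.cast_smul_eq_nsmul ℚ, smul_smul, mul_one_div_cancel (by positivity), one_smul]
  have hle : ∀ a b γ δ, rel a γ → rel b δ → (w a ≤ w b ↔ δ ≤ γ) := by
    rintro a b γ δ ⟨n, hn, c, hc, e, hγ⟩ ⟨m, hm, d, hd, e', hδ⟩
    have h1 : w a ^ (n * m) = w (algebraMap K L (c ^ m)) := by
      rw [pow_mul, e, map_pow, map_pow]
    have h2 : w b ^ (n * m) = w (algebraMap K L (d ^ n)) := by
      rw [mul_comm, pow_mul, e', map_pow, map_pow]
    rw [← pow_le_pow_iff_left₀ zero_le zero_le (Nat.mul_pos hn hm).ne', h1, h2,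
      hK _ _ (pow_ne_zero _ hd), ν₀.map_pow, ν₀.map_pow, hγ, hδ, ← WithTop.coe_nsmul,
      ← WithTop.coe_nsmul, WithTop.coe_le_coe, smul_smul, smul_smul, mul_comm m n,
      nsmul_le_nsmul_iff_of_pos (Nat.mul_pos hn hm)]
  have huniq : ∀ a γ δ, rel a γ → rel a δ → γ = δ := fun a γ δ h h' =>
    le_antisymm ((hle a a δ γ h' h).1 le_rfl) ((hle a a γ δ h h').1 le_rfl)
  have hmul : ∀ a b γ δ, rel a γ → rel b δ → rel (a * b) (γ + δ) := by
    rintro a b γ δ ⟨n, hn, c, hc, e, hγ⟩ ⟨m, hm, d, hd, e', hδ⟩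
    refine ⟨n * m, Nat.mul_pos hn hm, c ^ m * d ^ n,
      mul_ne_zero (pow_ne_zero _ hc) (pow_ne_zero _ hd), ?_, ?_⟩
    · rw [map_mul, mul_pow, map_mul, map_mul, map_pow, map_pow, map_pow, map_pow, ← e, ← e',
        ← pow_mul, ← pow_mul, mul_comm m n]
    · rw [ν₀.map_mul, ν₀.map_pow, ν₀.map_pow, hγ, hδ, ← WithTop.coe_nsmul,
        ← WithTop.coe_nsmul, ← WithTop.coe_add, smul_smul, smul_smul, smul_add, mul_comm m n]
  have hconst : ∀ c : K, c ≠ 0 → ∀ γ : Γ, ν₀ c = γ → rel (algebraMap K L c) γ := by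
    intro c hc γ h
    exact ⟨1, one_pos, c, hc, pow_one _, by rw [one_smul, h]⟩
  choose! val hval using hex
  let f : L → WithTop Γ := fun a => if a = 0 then ⊤ else (val a : WithTop Γ)
  have f0 : f 0 = ⊤ := if_pos rfl
  have fne : ∀ a, a ≠ 0 → f a = val a := fun a ha => if_neg ha
  have fK : ∀ c, f (algebraMap K L c) = ν₀ c := by
    intro c
    rcases eq_or_ne c 0 with rfl | hc
    · rw [map_zero, f0, ν₀.map_zero]
    · have hc' : algebraMap K L c ≠ 0 := by simpa using hc
      obtain ⟨γ, hγ⟩ := WithTop.ne_top_iff_exists.1 (ν₀.ne_top_iff.2 hc)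
      rw [fne _ hc', huniq _ _ _ (hval _ hc') (hconst c hc γ hγ.symm), hγ]
  have fle : ∀ a b, f b ≤ f a ↔ w a ≤ w b := by
    intro a b
    rcases eq_or_ne a 0 with rfl | ha
    · simp [f0]
    rcases eq_or_ne b 0 with rfl | hb
    · rw [f0, fne a ha, top_le_iff, map_zero, le_zero_iff, Valuation.zero_iff]
      simp [ha]
    · rw [fne a ha, fne b hb, WithTop.coe_le_coe, hle a b _ _ (hval a ha) (hval b hb)]
  have f1 : f 1 = 0 := by
    have := fK 1
    rwa [map_one, ν₀.map_one] at this
  refine ⟨AddValuation.of f f0 f1 (fun a b => ?_) (fun a b => ?_), fK, fun a => ?_⟩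
  · rw [min_le_iff, fle, fle, ← le_max_iff]
    exact w.map_add a b
  · rcases eq_or_ne a 0 with rfl | ha
    · rw [zero_mul, f0, top_add]
    rcases eq_or_ne b 0 with rfl | hb
    · rw [mul_zero, f0, add_top]
    have hab := mul_ne_zero ha hb
    rw [fne _ hab, fne a ha, fne b hb, ← WithTop.coe_add,
      huniq _ _ _ (hval _ hab) (hmul _ _ _ _ (hval a ha) (hval b hb))]
  · rw [AddValuation.of_apply, ← f1, fle, map_one, hw, V.valuation_le_one_iff]

/-- Let `μ` be a valuation on `K[x]` extending `ν₀` and `F` an irreducible polynomial whose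
initial form is not a unit. Then some valuation with support `(F)` lies above `μ`: the
polynomials of positive value generate a proper ideal in the image in `K[x]/(F)` of those of
non-negative value, so Chevalley's theorem gives a valuation ring there. -/
theorem exists_mem_valsSupp_of_forall_not_lt [Module ℚ Γ] {F : K[X]} (hF : Irreducible F)
    {μ : AddValuation K[X] (WithTop Γ)} (hμ : μ ∈ extVals ν₀)
    (hunit : ∀ g, ¬ 0 < μ (1 - F * g)) : ∃ μ' ∈ valsSupp ν₀ F, ValLE μ μ' := by
  have : Fact (Irreducible F) := ⟨hF⟩
  have : FiniteDimensional K (AdjoinRoot F) := (AdjoinRoot.powerBasis hF.ne_zero).finite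
  set φ : K[X] →+* AdjoinRoot F := AdjoinRoot.mk F with hφ
  have hφC : ∀ c : K, φ (C c) = algebraMap K (AdjoinRoot F) c := fun c => AdjoinRoot.mk_C c
  let A : Subring (AdjoinRoot F) :=
    { carrier := {a | ∃ f, 0 ≤ μ f ∧ φ f = a}
      zero_mem' := ⟨0, by simp, map_zero φ⟩
      one_mem' := ⟨1, by simp, map_one φ⟩
      add_mem' := by
        rintro _ _ ⟨f, hf, rfl⟩ ⟨g, hg, rfl⟩
        exact ⟨f + g, μ.map_le_add hf hg, map_add φ f g⟩
      mul_mem' := by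
        rintro _ _ ⟨f, hf, rfl⟩ ⟨g, hg, rfl⟩
        exact ⟨f * g, by rw [μ.map_mul]; exact add_nonneg hf hg, map_mul φ f g⟩
      neg_mem' := by
        rintro _ ⟨f, hf, rfl⟩
        exact ⟨-f, by rwa [μ.map_neg], map_neg φ f⟩ }
  let I : Ideal A :=
    { carrier := {a | ∃ f, 0 < μ f ∧ φ f = a}
      zero_mem' := ⟨0, by rw [μ.map_zero]; exact WithTop.coe_lt_top 0, map_zero φ⟩
      add_mem' := by
        rintro a b ⟨f, hf, ef⟩ ⟨g, hg, eg⟩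
        exact ⟨f + g, μ.map_lt_add hf hg, by rw [map_add, ef, eg]; rfl⟩
      smul_mem' := by
        rintro ⟨a, f, hf, rfl⟩ b ⟨g, hg, eg⟩
        exact ⟨f * g, by rw [μ.map_mul]; exact hg.trans_le (le_add_of_nonneg_left hf),
          by rw [map_mul, eg]; rfl⟩ }
  have hI : I ≠ ⊤ := by
    intro h
    obtain ⟨f, hf, e⟩ : (1 : A) ∈ I := h ▸ Submodule.mem_top
    obtain ⟨g, hg⟩ : F ∣ 1 - f := by
      rw [← AdjoinRoot.mk_eq_zero, map_sub, map_one, sub_eq_zero]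
      exact e.symm
    refine hunit g ?_
    rwa [← hg, sub_sub_cancel]
  obtain ⟨V, hAV, hIV⟩ := Ideal.image_subset_nonunits_valuationSubring I hI
  have hge : ∀ f, 0 ≤ μ f → φ f ∈ V := fun f hf => hAV ⟨f, hf, rfl⟩
  have hgt : ∀ f, 0 < μ f → φ f ∈ V.nonunits := fun f hf =>
    hIV ⟨⟨φ f, f, hf.le, rfl⟩, ⟨f, hf, rfl⟩, rfl⟩
  obtain ⟨v, hvK, hvV⟩ := exists_addValuation_of_valuationSubring (ν₀ := ν₀) V fun c => by
    constructor
    · intro hc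
      by_contra! hlt
      -- the inverse of `c` has positive value, so it is not a unit of `V`
      have hc0 : c ≠ 0 := by rintro rfl; simp at hlt
      have hpos : 0 < μ (C c⁻¹) := by
        rw [hμ]
        by_contra! hle
        have h1 : ν₀ c + ν₀ c⁻¹ = 0 := by rw [← ν₀.map_mul, mul_inv_cancel₀ hc0, ν₀.map_one]
        have h2 : ν₀ c + ν₀ c⁻¹ ≤ ν₀ c + 0 := by gcongr
        rw [h1, add_zero] at h2
        exact hlt.not_ge h2
      have := V.mem_nonunits_iff.1 (hgt _ hpos)
      rw [hφC, map_inv₀, map_inv₀] at this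
      have hw : V.valuation (algebraMap K _ c) ≤ 1 := (V.valuation_le_one_iff _).2 hc
      have hw0 : 0 < V.valuation (algebraMap K (AdjoinRoot F) c) :=
        zero_lt_iff.2 ((Valuation.ne_zero_iff _).2 (by simpa using hc0))
      exact ((one_le_inv₀ hw0).2 hw).not_gt this
    · intro hc
      rw [← hφC]
      exact hge _ (by rwa [hμ])
  have hvpos : ∀ f, 0 < μ f → 0 < v (φ f) := by
    intro f hf
    rcases eq_or_ne (φ f) 0 with h0 | h0
    · rw [h0, v.map_zero]
      exact WithTop.coe_lt_top 0
    refine lt_of_le_of_ne ((hvV _).2 (hge f hf.le)) fun e => ?_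
    have hinv : (φ f)⁻¹ ∈ V := by
      rw [← hvV]
      have h1 : v (φ f) + v (φ f)⁻¹ = 0 := by rw [← v.map_mul, mul_inv_cancel₀ h0, v.map_one]
      rw [← e, zero_add] at h1
      exact h1.ge
    have hw := V.mem_nonunits_iff.1 (hgt f hf)
    have hw' := (V.valuation_le_one_iff _).2 hinv
    rw [map_inv₀, inv_le_one₀ (zero_lt_iff.2 ((Valuation.ne_zero_iff _).2 h0))] at hw'
    exact hw.not_ge hw'
  refine ⟨v.comap φ, ⟨fun c => ?_, ?_⟩, fun f => ?_⟩
  · change v (φ (C c)) = _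
    rw [hφC, hvK]
  · ext f
    rw [AddValuation.mem_supp_iff, Ideal.mem_span_singleton, ← AdjoinRoot.mk_eq_zero]
    exact v.top_iff
  · change μ f ≤ v (φ f)
    by_contra! hlt
    -- compare a power of `f` with a constant that has the value of the same power of `φ f`
    have h0 : φ f ≠ 0 := by intro h; rw [h, v.map_zero] at hlt; exact not_top_lt hlt
    obtain ⟨n, hn, c, hc, e⟩ := exists_pow_valuation_eq (K := K) v.toValuation h0
    have e' : v (φ f ^ n) = ν₀ c := by
      rw [← map_pow] at e
      rw [← hvK]
      exact e
    obtain ⟨γ, hγ⟩ := WithTop.ne_top_iff_exists.1 (v.ne_top_iff.2 h0)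
    have hcinv : ((n • γ : Γ) : WithTop Γ) + ν₀ c⁻¹ = 0 := by
      rw [WithTop.coe_nsmul, hγ, ← v.map_pow, e', ← ν₀.map_mul, mul_inv_cancel₀ hc, ν₀.map_one]
    have hcinv_ne : ν₀ c⁻¹ ≠ ⊤ := ν₀.ne_top_iff.2 (inv_ne_zero hc)
    have hpow : ((n • γ : Γ) : WithTop Γ) < μ (f ^ n) := by
      rw [← hγ] at hlt
      rw [μ.map_pow]
      cases hf : μ f with
      | top =>
        obtain ⟨k, rfl⟩ := Nat.exists_eq_succ_of_ne_zero hn.ne'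
        rw [Nat.succ_eq_add_one, succ_nsmul (⊤ : WithTop Γ), add_top]
        exact WithTop.coe_lt_top _
      | coe δ =>
        rw [hf, WithTop.coe_lt_coe] at hlt
        rw [← WithTop.coe_nsmul, WithTop.coe_lt_coe]
        exact nsmul_right_strictMono hn.ne' hlt
    have hpos : 0 < μ (f ^ n * C c⁻¹) := by
      rw [μ.map_mul, hμ, ← hcinv]
      exact WithTop.add_lt_add_right hcinv_ne hpow
    refine (hvpos _ hpos).ne' ?_
    rw [map_mul, map_pow, hφC, v.map_mul, hvK, e', ← ν₀.map_mul, mul_inv_cancel₀ hc, ν₀.map_one]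

end Extension

/-! ### The first side of a Newton polygon -/

theorem mem_newtonRegion {Γ : Type*} [AddCommGroup Γ] [LinearOrder Γ] [Module ℚ Γ]
    {w : ℕ → WithTop Γ} {i : ℕ} {b : Γ} (h : w i = b) : ((i : ℚ), b) ∈ newtonRegion w :=
  subset_convexHull ℚ _ ⟨i, rfl, h.le⟩

section NewtonSlope

variable {Γ : Type*} [AddCommGroup Γ] [LinearOrder Γ] [IsOrderedAddMonoid Γ] [Module ℚ Γ]

theorem rat_smul_pos {q : ℚ} (hq : 0 < q) {x : Γ} (hx : 0 < x) : 0 < q • x := by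
  by_contra! h
  have e : q.den • (q • x) = q.num.toNat • x := by
    have hnum : (q.num.toNat : ℚ) = (q.num : ℚ) := by
      exact_mod_cast Int.toNat_of_nonneg (Rat.num_pos.2 hq).le
    rw [← Nat.cast_smul_eq_nsmul ℚ, ← Nat.cast_smul_eq_nsmul ℚ, smul_smul, mul_comm,
      Rat.mul_den_eq_num, hnum]
  have h1 : q.den • (q • x) ≤ 0 := nsmul_nonpos h _
  have h2 : 0 < q.num.toNat • x := nsmul_pos hx (by have := Rat.num_pos.2 hq; omega)
  exact absurd (e ▸ h1) h2.not_ge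

theorem rat_smul_nonneg {q : ℚ} (hq : 0 ≤ q) {x : Γ} (hx : 0 ≤ x) : 0 ≤ q • x := by
  rcases hq.eq_or_lt with rfl | hq
  · rw [zero_smul]
  rcases hx.eq_or_lt with rfl | hx
  · rw [smul_zero]
  exact (rat_smul_pos hq hx).le

variable {w : ℕ → WithTop Γ} {a α : Γ}

/-- A line of slope `-α` below all the points lies below their convex hull. -/
theorem le_of_mem_newtonRegion (h : ∀ i, (a : WithTop Γ) ≤ w i + ((i • α : Γ) : WithTop Γ))
    {p : ℚ × Γ} (hp : p ∈ newtonRegion w) : a ≤ p.2 + p.1 • α := by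
  have hconv : Convex ℚ {p : ℚ × Γ | a ≤ p.2 + p.1 • α} := by
    intro x hx y hy s t hs ht hst
    have hx' : 0 ≤ s • (x.2 + x.1 • α - a) := rat_smul_nonneg hs (sub_nonneg.2 hx)
    have hy' : 0 ≤ t • (y.2 + y.1 • α - a) := rat_smul_nonneg ht (sub_nonneg.2 hy)
    have e : (s • x + t • y).2 + (s • x + t • y).1 • α - a =
        s • (x.2 + x.1 • α - a) + t • (y.2 + y.1 • α - a) := by
      have ha : a = s • a + t • a := by rw [← add_smul, hst, one_smul]
      conv_lhs => rw [ha]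
      simp only [Prod.snd_add, Prod.fst_add, Prod.smul_fst, Prod.smul_snd, smul_eq_mul,
        smul_sub, smul_add, add_smul, mul_smul]
      abel
    change a ≤ _
    rw [← sub_nonneg, e]
    exact add_nonneg hx' hy'
  refine convexHull_min ?_ hconv hp
  rintro ⟨x, y⟩ ⟨i, rfl, hi⟩
  change a ≤ y + (i : ℚ) • α
  rw [Nat.cast_smul_eq_nsmul, ← WithTop.coe_le_coe, WithTop.coe_add]
  exact (h i).trans (by gcongr)

/-- If the line of slope `-α` through `(0, w 0)` lies below all the points, and `k > 0` is the
index of the last point on it, then `-α` is the slope of the first side. -/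
theorem isFirstSlope_neg {k : ℕ} (hk : 0 < k) (h0 : w 0 = a)
    (hle : ∀ i, (a : WithTop Γ) ≤ w i + ((i • α : Γ) : WithTop Γ))
    (hlt : ∀ i, k < i → (a : WithTop Γ) < w i + ((i • α : Γ) : WithTop Γ))
    (hwk : w k + ((k • α : Γ) : WithTop Γ) = a) : IsFirstSlope w (-α) := by
  obtain ⟨b, hb⟩ : ∃ b : Γ, w k = b := by
    cases h : w k with
    | top => rw [h, top_add] at hwk; exact absurd hwk WithTop.top_ne_coe
    | coe b => exact ⟨b, rfl⟩
  have hab : b = a - (k : ℚ) • α := by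
    rw [hb, ← WithTop.coe_add, WithTop.coe_inj] at hwk
    rw [← hwk, Nat.cast_smul_eq_nsmul, add_sub_cancel_right]
  have hk0 : (k : ℚ) ≠ 0 := by positivity
  refine ⟨k, hk, ⟨a, b, h0, hb, fun p hp => ?_⟩, fun l hl => ?_, a, b, h0, hb, ?_⟩
  · refine ⟨(convex_convexHull ℚ _).segment_subset (mem_newtonRegion h0) (mem_newtonRegion hb) hp,
      fun y hy => ?_⟩
    obtain ⟨s, t, hs, ht, hst, rfl⟩ := hp
    have := le_of_mem_newtonRegion hle hy
    rw [← sub_le_iff_le_add] at this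
    refine le_trans (le_of_eq ?_) this
    have ha : a = s • a + t • a := by rw [← add_smul, hst, one_smul]
    conv_rhs => rw [ha]
    simp [hab, smul_sub, mul_smul]
    abel
  · by_contra! hkl
    obtain ⟨a', c, ha', hc, hseg⟩ := hl
    obtain rfl : a = a' := by rw [h0] at ha'; exact WithTop.coe_injective ha'
    have hl0 : (0 : ℚ) < l := by exact_mod_cast hk.trans hkl
    have hmem : ((k : ℚ), a + ((k : ℚ) / l) • (c - a)) ∈ newtonPolygon w := by
      refine hseg ⟨1 - k / l, k / l, ?_, by positivity, by ring, ?_⟩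
      · rw [sub_nonneg, div_le_one hl0]
        exact_mod_cast hkl.le
      · ext
        · simp
          field_simp
        · simp [smul_sub, sub_smul]
          abel
    have hle' := hmem.2 _ (mem_newtonRegion hb)
    have hpos := hlt l hkl
    rw [hc, ← WithTop.coe_add, WithTop.coe_lt_coe] at hpos
    have h1 : 0 < ((k : ℚ) / l) • (c + l • α - a) :=
      rat_smul_pos (by positivity) (sub_pos.2 hpos)
    have e : ((k : ℚ) / l) • (c + l • α - a) =
        (a + ((k : ℚ) / l) • (c - a)) - b := by
      rw [hab, ← Nat.cast_smul_eq_nsmul ℚ]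
      simp only [smul_sub, smul_add, smul_smul]
      rw [div_mul_cancel₀ _ hl0.ne']
      abel
    rw [e, sub_pos] at h1
    exact h1.not_ge hle'
  · rw [hab, sub_sub_cancel_left, smul_neg, smul_smul, one_div_mul_cancel hk0, one_smul]

/-- The first side exists as soon as some point other than `(0, w 0)` is finite: `α` is the
largest of the quotients `(w 0 - w i) / i`, and `k` is the last index where it is attained. -/
theorem exists_first_side {N : ℕ} (hN : ∀ i, N < i → w i = ⊤)
    (hfin : ∃ i, 0 < i ∧ w i ≠ ⊤) (h0 : w 0 = a) :
    ∃ (α : Γ) (k : ℕ), 0 < k ∧ (∀ i, (a : WithTop Γ) ≤ w i + ((i • α : Γ) : WithTop Γ)) ∧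
      (∀ i, k < i → (a : WithTop Γ) < w i + ((i • α : Γ) : WithTop Γ)) ∧
      w k + ((k • α : Γ) : WithTop Γ) = a := by
  classical
  set S := (Finset.range (N + 1)).filter fun i => 0 < i ∧ w i ≠ ⊤ with hS
  have hmemS : ∀ i, i ∈ S ↔ 0 < i ∧ w i ≠ ⊤ := fun i => by
    rw [hS, Finset.mem_filter, Finset.mem_range]
    refine ⟨fun h => h.2, fun h => ⟨?_, h⟩⟩
    by_contra! hi
    exact h.2 (hN i (by omega))
  obtain ⟨i₀, hi₀⟩ := hfin
  let g : ℕ → Γ := fun i => (1 / (i : ℚ)) • (a - (w i).untopD 0)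
  have hg : ∀ i ∈ S, ∃ b : Γ, w i = b ∧ i • g i = a - b := by
    intro i hi
    obtain ⟨hpos, hne⟩ := (hmemS i).1 hi
    obtain ⟨b, hb⟩ := WithTop.ne_top_iff_exists.1 hne
    refine ⟨b, hb.symm, ?_⟩
    simp only [g]
    rw [← hb, WithTop.untopD_coe, ← Nat.cast_smul_eq_nsmul ℚ, smul_smul,
      mul_one_div_cancel (by positivity), one_smul]
  obtain ⟨j, hj, hmax⟩ := S.exists_max_image g ⟨i₀, (hmemS i₀).2 hi₀⟩
  set T := S.filter fun i => g i = g j with hT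
  have hTne : T.Nonempty := ⟨j, by rw [hT, Finset.mem_filter]; exact ⟨hj, rfl⟩⟩
  obtain ⟨hkS, hkg⟩ := Finset.mem_filter.1 (T.max'_mem hTne)
  refine ⟨g j, T.max' hTne, ((hmemS _).1 hkS).1, fun i => ?_, fun i hi => ?_, ?_⟩
  · rcases Nat.eq_zero_or_pos i with rfl | hpos
    · simp [h0]
    by_cases htop : w i = ⊤
    · simp [htop]
    have hiS := (hmemS i).2 ⟨hpos, htop⟩
    obtain ⟨b, hb, e⟩ := hg i hiS
    rw [hb, ← WithTop.coe_add, WithTop.coe_le_coe, ← sub_le_iff_le_add', ← e]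
    exact nsmul_le_nsmul_right (hmax i hiS) i
  · by_cases htop : w i = ⊤
    · rw [htop, top_add]
      exact WithTop.coe_lt_top _
    have hpos : 0 < i := by omega
    have hiS := (hmemS i).2 ⟨hpos, htop⟩
    obtain ⟨b, hb, e⟩ := hg i hiS
    rw [hb, ← WithTop.coe_add, WithTop.coe_lt_coe, ← sub_lt_iff_lt_add', ← e]
    refine nsmul_right_strictMono hpos.ne' (lt_of_le_of_ne (hmax i hiS) fun h => ?_)
    have := T.le_max' i (by rw [hT, Finset.mem_filter]; exact ⟨hiS, h⟩)
    omega
  · obtain ⟨b, hb, e⟩ := hg _ hkS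
    rw [hkg] at e
    rw [hb, ← WithTop.coe_add, e, add_sub_cancel]

end NewtonSlope

/-! ### Valuations above an augmentation -/

section Above

variable {Γ : Type*} [AddCommGroup Γ] [LinearOrder Γ] [IsOrderedAddMonoid Γ]
variable {K : Type*} [Field K] {ν : AddValuation K[X] (WithTop Γ)} {Q : K[X]} {α : Γ}

/-- If the initial form of `Q` divides that of `f`, reduction modulo `Q` raises the value:
otherwise `f %ₘ Q`, of degree less than `deg Q`, would have an initial form divisible by that of
`Q`. -/
theorem IsKeyPoly.lt_mod_of_dvd (hQ : IsKeyPoly ν Q) {f : K[X]} (hf : f ≠ 0)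
    (h : initialForm ν Q ∣ initialForm ν f) : ν f < ν (f %ₘ Q) := by
  refine lt_of_le_of_ne (hQ.isResidualKey.le_mod f) fun e => ?_
  have hne := hQ.ne_top_of_ne_zero f hf
  obtain ⟨g, hg⟩ := (initialForm_dvd_iff hQ.map_ne_top hne).1 h
  have hr : f %ₘ Q ≠ 0 := by
    intro h0
    rw [h0, ν.map_zero] at e
    exact hne e
  have hdvd : initialForm ν Q ∣ initialForm ν (f %ₘ Q) := by
    refine (initialForm_dvd_iff hQ.map_ne_top (hQ.ne_top_of_ne_zero _ hr)).2
      ⟨g - f /ₘ Q, ?_⟩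
    rw [← e]
    convert hg using 2
    rw [modByMonic_eq_sub_mul_div]
    ring
  exact absurd (hQ.2.2 _ hr hdvd)
    (natDegree_lt_natDegree hr (degree_modByMonic_lt f hQ.1)).not_ge

theorem IsResidualKey.irreducible (hQ : IsResidualKey ν Q) : Irreducible Q := by
  refine (hQ.monic.irreducible_iff_natDegree').2 ⟨?_, fun f g hf hg hfg hmem => ?_⟩
  · rintro rfl
    simpa using hQ.natDegree_pos
  rw [Finset.mem_Ioc] at hmem
  have hdeg : f.natDegree + g.natDegree = Q.natDegree := by
    rw [← hfg, hf.natDegree_mul hg]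
  have := hQ.mul_mod f g (degree_lt_degree (by omega)) (degree_lt_degree (by omega))
  rw [hfg, modByMonic_self hQ.monic, ν.map_zero] at this
  exact WithTop.add_ne_top.2 ⟨hQ.ne_top f hf.ne_zero, hQ.ne_top g hg.ne_zero⟩ this.symm

theorem IsResidualKey.exists_inverse (hQ : IsResidualKey ν Q) {a : K[X]} (h0 : a ≠ 0)
    (ha : a.degree < Q.degree) : ∃ b : K[X], b.degree < Q.degree ∧ (a * b) %ₘ Q = 1 := by
  have hnd : ¬ Q ∣ a := fun h => by
    rw [← modByMonic_eq_zero_iff_dvd hQ.monic, (modByMonic_eq_self_iff hQ.monic).2 ha] at h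
    exact h0 h
  obtain ⟨u, v, e⟩ := (hQ.irreducible.coprime_iff_not_dvd).2 hnd
  refine ⟨v %ₘ Q, degree_modByMonic_lt _ hQ.monic, ?_⟩
  have h1 : (1 : K[X]) %ₘ Q = 1 := by
    rw [modByMonic_eq_self_iff hQ.monic, degree_one]
    exact natDegree_pos_iff_degree_pos.1 hQ.natDegree_pos
  rw [← h1]
  refine modByMonic_eq_of_dvd_sub hQ.monic ⟨-u - a * (v /ₘ Q), ?_⟩
  rw [modByMonic_eq_sub_mul_div]
  linear_combination e

/-- Above the augmentation, polynomials of degree less than `deg Q` keep their value: such a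
polynomial has an inverse modulo `Q`, and the value of neither can rise. -/
theorem map_eq_of_augVal_le (hQ : IsResidualKey ν Q) (hα : ν Q < α)
    {μ : AddValuation K[X] (WithTop Γ)} (hμ : ValLE (augVal hQ hα) μ) {a : K[X]}
    (ha : a.degree < Q.degree) : μ a = ν a := by
  have hle : ∀ c : K[X], c.degree < Q.degree → ν c ≤ μ c := fun c hc => by
    rw [← augVal_of_degree_lt hQ hα hc]
    exact hμ c
  rcases eq_or_ne a 0 with rfl | h0
  · simp
  obtain ⟨b, hb, hab⟩ := hQ.exists_inverse h0 ha
  have hb0 : b ≠ 0 := by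
    rintro rfl
    simp at hab
  have hν : ν a + ν b = 0 := by rw [← hQ.mul_mod a b ha hb, hab, ν.map_one]
  obtain ⟨A, hA⟩ := WithTop.ne_top_iff_exists.1 (hQ.ne_top a h0)
  obtain ⟨B, hB⟩ := WithTop.ne_top_iff_exists.1 (hQ.ne_top b hb0)
  have hcarry : 0 < μ (Q * ((a * b) /ₘ Q)) := by
    have := lt_carry hQ hα (A := A) (B := B) (a := a) (b := b) (i := 0) (j := 0)
      (by simp [hA]) (by simp [hB])
    rw [WithTop.coe_add, hA, hB, hν, zero_add, zero_add, one_smul] at this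
    refine this.trans_le ((le_of_eq ?_).trans (hμ _))
    rw [AddValuation.map_mul, augVal_self,
      augVal_of_degree_lt hQ hα (degree_divByMonic_mul_lt hQ.monic ha hb), add_comm]
  have hμab : μ a + μ b = 0 := by
    rw [← μ.map_mul, ← modByMonic_add_div (a * b) Q, hab,
      μ.map_add_eq_of_lt_left (by rwa [μ.map_one]), μ.map_one]
  refine ((hle a ha).antisymm' (not_lt.1 fun hlt => ?_))
  have h1 : ν a + ν b < μ a + ν b :=
    WithTop.add_lt_add_right (hQ.ne_top b hb0) hlt
  have h2 : μ a + ν b ≤ μ a + μ b := by gcongr; exact hle b hb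
  rw [hν] at h1
  rw [hμab] at h2
  exact h1.not_ge h2

/-- If the constant term of the `Q`-expansion of `F` has the least value, then `Q` keeps its
value in every valuation of support `(F)` above the augmentation: otherwise the constant term
would be the only one of least value, and the value of `F` would be finite. -/
theorem map_self_eq_of_augVal_le (hQ : IsResidualKey ν Q) (hα : ν Q < α) {F : K[X]} {a : Γ}
    (h0 : ν (expCoeff Q F 0) = a) (hF : ∀ i, (a : WithTop Γ) ≤ termVal ν Q α F i)
    {μ : AddValuation K[X] (WithTop Γ)} (hμ : ValLE (augVal hQ hα) μ) (hμF : μ F = ⊤) :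
    μ Q = α := by
  have hge : (α : WithTop Γ) ≤ μ Q := by
    rw [← augVal_self hQ hα]
    exact hμ Q
  refine hge.antisymm' (not_lt.1 fun hlt => ?_)
  have hcoef : ∀ i, μ (expCoeff Q F i) = ν (expCoeff Q F i) := fun i =>
    map_eq_of_augVal_le hQ hα hμ (degree_expCoeff_lt hQ.monic F i)
  have hterm : ∀ i, (a : WithTop Γ) < μ (expCoeff Q F (i + 1) * Q ^ (i + 1)) := by
    intro i
    rw [μ.map_mul, μ.map_pow, hcoef]
    by_cases htop : ν (expCoeff Q F (i + 1)) = ⊤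
    · rw [htop, top_add]
      exact WithTop.coe_lt_top _
    refine (hF (i + 1)).trans_lt (WithTop.add_lt_add_left htop ?_)
    rw [WithTop.coe_nsmul, succ_nsmul (α : WithTop Γ), succ_nsmul (μ Q), ← WithTop.coe_nsmul]
    refine (WithTop.add_lt_add_left WithTop.coe_ne_top hlt).trans_le ?_
    gcongr
    rw [WithTop.coe_nsmul]
    exact nsmul_le_nsmul_right hge i
  have hsum := sum_expCoeff hQ.monic hQ.natDegree_pos F _ (Nat.lt_succ_self F.natDegree)
  rw [Nat.succ_eq_add_one, Finset.sum_range_succ', pow_zero, mul_one, add_comm] at hsum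
  have hlt' : (a : WithTop Γ) <
      μ (∑ i ∈ Finset.range F.natDegree, expCoeff Q F (i + 1) * Q ^ (i + 1)) :=
    μ.map_lt_sum WithTop.coe_ne_top fun i _ => hterm i
  rw [hsum, μ.map_add_eq_of_lt_left (by rwa [hcoef, h0]), hcoef, h0] at hμF
  exact WithTop.coe_ne_top hμF

theorem augVal_mem_extVals {ν₀ : AddValuation K (WithTop Γ)} (hν : ν ∈ extVals ν₀)
    (hQ : IsResidualKey ν Q) (hα : ν Q < α) : augVal hQ hα ∈ extVals ν₀ := fun c => by
  rw [augVal_of_degree_lt hQ hα (degree_C_le.trans_lt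
    (natDegree_pos_iff_degree_pos.1 hQ.natDegree_pos)), hν]

/-- If the initial form of `Q` divides that of `F`, some term of positive degree of the
`Q`-expansion has smaller value than the constant term. -/
theorem IsKeyPoly.exists_term_lt (hQ : IsKeyPoly ν Q) {F : K[X]} (hF : F ≠ 0)
    (h : initialForm ν Q ∣ initialForm ν F) :
    ∃ i, 0 < i ∧ ν (expCoeff Q F i) + i • ν Q < ν (expCoeff Q F 0) := by
  by_contra! hall
  refine (hQ.lt_mod_of_dvd hF h).not_ge ?_
  conv_rhs => rw [sum_expCoeff hQ.1 hQ.natDegree_pos F _ (Nat.lt_succ_self _)]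
  refine ν.map_le_sum fun i _ => ?_
  rcases Nat.eq_zero_or_pos i with rfl | hi
  · simp [expCoeff_zero_right]
  · rw [ν.map_mul, ν.map_pow]
    exact hall i hi

end Above

end ValApproach

end

open Polynomial ValApproach in
theorem theorem1p5 {K : Type*} [Field K]
    {Γ : Type*} [AddCommGroup Γ] [LinearOrder Γ] [IsOrderedAddMonoid Γ] [Module ℚ Γ]
    (ν₀ : AddValuation K (WithTop Γ)) (F : K[X]) (hFmonic : F.Monic) (hFirr : Irreducible F)
    (ν : AddValuation K[X] (WithTop Γ)) (hν : ν ∈ valsApproaching ν₀ F)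
    (hνmax : ¬ IsMaximalVal ν₀ ν)
    (φ : Gr ν) (hφhom : IsHomogeneousElem ν φ) (hφirr : Irreducible φ)
    (hφF : φ ∣ initialForm ν F)
    (u : (Gr ν)ˣ) (Q : K[X]) (hQ : IsKeyPoly ν Q) (hφQ : φ = u * initialForm ν Q) :
    ∃ α₁ : WithTop Γ,
      (Q ≠ F → ∃ s : Γ, IsFirstSlopeOf ν Q F s ∧ α₁ = ((-s : Γ) : WithTop Γ)) ∧
      (Q = F → α₁ = ⊤) ∧
      ν Q < α₁ ∧
      ∃ μ ∈ valsApproaching ν₀ F, μ Q = α₁ ∧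
        ∀ μ' ∈ valsApproaching ν₀ F, ValLE μ μ' → μ' Q = α₁ := by
  rcases eq_or_ne Q F with rfl | hne
  · -- every valuation of support `(F)` above `ν` will do
    obtain ⟨-, μ, hμ, -⟩ := hν
    have htop : μ Q = ⊤ := by
      rw [← AddValuation.mem_supp_iff, hμ.2]
      exact Ideal.mem_span_singleton_self Q
    refine ⟨⊤, fun h => absurd rfl h, fun _ => rfl, lt_top_iff_ne_top.2 hQ.map_ne_top, μ,
      ⟨hμ.1, μ, hμ, fun _ => le_rfl⟩, htop, fun μ' _ hle => ?_⟩
    rw [eq_top_iff, ← htop]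
    exact hle Q
  have hR := hQ.isResidualKey
  have hdvd : initialForm ν Q ∣ initialForm ν F := (Dvd.intro_left _ hφQ.symm).trans hφF
  have hf0 : expCoeff Q F 0 ≠ 0 := by
    intro h
    have hQF : Q ∣ F := (modByMonic_eq_zero_iff_dvd hQ.1).1 h
    exact hne (eq_of_monic_of_associated hQ.1 hFmonic
      (hR.irreducible.associated_of_dvd hFirr hQF))
  obtain ⟨a, ha⟩ := WithTop.ne_top_iff_exists.1 (hR.ne_top _ hf0)
  obtain ⟨β, hβ⟩ := WithTop.ne_top_iff_exists.1 hQ.map_ne_top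
  obtain ⟨i, hi, hilt⟩ := hQ.exists_term_lt hFirr.ne_zero hdvd
  have hifin : ν (expCoeff Q F i) ≠ ⊤ := by
    intro h
    rw [h, top_add] at hilt
    exact not_top_lt hilt
  obtain ⟨α, k, hk, hle, hlt, hkeq⟩ := exists_first_side (w := fun i => ν (expCoeff Q F i))
    (N := F.natDegree) (fun i hi => by
      rw [expCoeff_eq_zero hQ.1 hQ.natDegree_pos hi, ν.map_zero])
    ⟨i, hi, hifin⟩ ha.symm
  have hα : ν Q < α := by
    obtain ⟨γ, hγ⟩ := WithTop.ne_top_iff_exists.1 hifin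
    have h := hilt.trans_le (ha.ge.trans (hle i))
    simp only [← hβ, ← hγ] at h ⊢
    rw [← WithTop.coe_nsmul, ← WithTop.coe_add, ← WithTop.coe_add, WithTop.coe_lt_coe,
      add_lt_add_iff_left] at h
    exact WithTop.coe_lt_coe.2 ((nsmul_right_strictMono hi.ne').lt_iff_lt.1 h)
  have hlead : IsLead ν Q α a k F := ⟨fun j => ⟨hle j, fun h => hlt j h⟩, hkeq⟩
  have hext := augVal_mem_extVals hν.1 hR hα
  refine ⟨α, fun _ => ⟨-α, isFirstSlope_neg hk ha.symm hle hlt hkeq, by rw [neg_neg]⟩,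
    fun h => absurd h hne, hα, augVal hR hα, ⟨hext, ?_⟩, augVal_self hR hα, ?_⟩
  · exact exists_mem_valsSupp_of_forall_not_lt hFirr hext
      (not_lt_augVal_one_sub_mul hR hα hlead hk)
  · rintro μ' ⟨-, μ'', ⟨-, hsupp⟩, hle''⟩ hle'
    have htop : μ'' F = ⊤ := by
      rw [← AddValuation.mem_supp_iff, hsupp]
      exact Ideal.mem_span_singleton_self F
    -- the value of `Q` under `μ'` lies between its values under `augVal hR hα` and `μ''`
    refine le_antisymm ?_ ?_
    · rw [← map_self_eq_of_augVal_le hR hα ha.symm hle (fun f => (hle' f).trans (hle'' f)) htop]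
      exact hle'' Q
    · rw [← augVal_self hR hα]
      exact hle' Q
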